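/- A matrix $\Phi\in\mathbb{R}^{Q\times N}$ has the $(k,\eta)$-restricted isometry property if $(1-\eta)\|x\|_2^2\le\|\Phi x\|_2^2\le(1+\eta)\|x\|_2^2$ for every $x\in\mathbb{R}^N$ with at most $k$ nonzero coordinates. A random vector $z\in\{-1,1\}^n$ is $\varepsilon$-biased $\ell$-wise independent if $\left|\mathbb{E}\prod_{i\in y}z_i\right|\le\varepsilon$ for every $y\subseteq\{1,\dots,n\}$ with $0<|y|\le\ell$. Theorem. Let $\eta>0$, $\theta>1$ and $A>0$. There are a constant $C>0$ and a randomized algorithm, depending only on $\eta,\theta,A$, such that for all integers $k\ge1$ and $N\ge\theta k$ there are integers $Q,r,\ell$ for which the following holds. On input $(N,k)$ and $r$ independent uniform random bits, the algorithm always outputs, in time polynomial in $N$, a matrix $\Phi\in\{-1/\sqrt Q,\,1/\sqrt Q\}^{Q\times N}$, where $$Q\le C\,k\log(N/k),\qquad r\le C\,k\log(k)\log(N/k),$$ and $$\Pr\left[\Phi\text{ has the }(k,\eta)\text{-restricted isometry property}\right]\ \ge\ 1-e^{-A\,k\log(N/k)}.$$ Moreover, the $QN$ signs of the entries of $\Phi$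 are $\varepsilon$-biased $\ell$-wise independent with $\tfrac1C\,k\log(N/k)\le\ell\le Q$ and $\varepsilon=(k^2Q/\ell)^{-\ell/2}$. Here the model of computation is a random access machine that can add, subtract (truncated at $0$), load, store, branch, loop and read a random bit, each at unit cost. -/

import Mathlib

open scoped BigOperators

/-! ### Matrices with the restricted isometry property -/

/-- A vector is `k`-sparse if at most `k` of its coordinates are nonzero. -/
def IsSparse {N : ℕ} (k : ℕ) (x : EuclideanSpace ℝ (Fin N)) : Prop :=
  {i | x i ≠ 0}.ncard ≤ k

/-- The `(k, η)`-restricted isometry property, with Euclidean norms. -/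
def HasRIP {Q N : ℕ} (k : ℕ) (η : ℝ) (Φ : Matrix (Fin Q) (Fin N) ℝ) : Prop :=
  ∀ x : EuclideanSpace ℝ (Fin N), IsSparse k x →
    (1 - η) * ‖x‖ ^ 2 ≤ ‖Matrix.toEuclideanLin Φ x‖ ^ 2 ∧
      ‖Matrix.toEuclideanLin Φ x‖ ^ 2 ≤ (1 + η) * ‖x‖ ^ 2

/-- The probability of the event `E` for the uniform distribution on the finite type `Ω`. -/
noncomputable def uniformProb {Ω : Type*} [Fintype Ω] (E : Set Ω) : ℝ :=
  (E.ncard : ℝ) / Fintype.card Ω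

/-- The random `±1`-vector `S ω`, for `ω` uniform in `Ω`, is `ε`-biased `ℓ`-wise independent. -/
def IsBiased {Ω ι : Type*} [Fintype Ω] (S : Ω → ι → ℤ) (ε : ℝ) (ℓ : ℕ) : Prop :=
  (∀ ω i, S ω i = 1 ∨ S ω i = -1) ∧
    ∀ y : Finset ι, 0 < y.card → y.card ≤ ℓ →
      |Finset.expect Finset.univ (fun ω => ∏ i ∈ y, (S ω i : ℝ))| ≤ ε

/-- The `Q × N` matrix with entries `± 1 / √Q` with the signs given by `S`. -/
noncomputable def scaledMatrix {Q N : ℕ} (S : Fin Q × Fin N → ℤ) : Matrix (Fin Q) (Fin N) ℝ :=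
  fun i j => (S (i, j) : ℝ) / √(Q : ℝ)

/-! ### Randomized random access machines

A machine has registers and a memory that is addressed indirectly, both holding natural numbers,
and a tape of random bits that is read once, from left to right. Every instruction costs one step.
The only arithmetic instructions are addition and truncated subtraction, so that `t` steps can
create only numbers with `O(t)` more bits than the input, and running times agree with those of
Turing machines up to a polynomial. -/

namespace RandRAM

/-- Programs of the machine. -/
inductive Prog : Type
  /-- register `d` becomes the constant `c` -/
  | const (d c : ℕ)
  /-- register `d` becomes the sum of registers `a` and `b` -/
  | add (d a b : ℕ)
  /-- register `d` becomes the truncated difference of registers `a` and `b` -/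
  | sub (d a b : ℕ)
  /-- register `d` becomes the content of the memory cell whose address is in register `a` -/
  | load (d a : ℕ)
  /-- the memory cell whose address is in register `a` gets the content of register `b` -/
  | store (a b : ℕ)
  /-- register `d` becomes the next random bit -/
  | coin (d : ℕ)
  /-- sequential composition -/
  | seq (p q : Prog)
  /-- run `p` if register `a` is nonzero, else `q` -/
  | branch (a : ℕ) (p q : Prog)
  /-- repeat `p` as long as register `a` is nonzero -/
  | loop (a : ℕ) (p : Prog)

/-- Configurations: registers, memory, and the random bits that are not yet read. -/
structure State : Type where
  reg : ℕ → ℕ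
  mem : ℕ → ℕ
  tape : List Bool

/-- Write `v` into register `d`. -/
def State.setReg (s : State) (d v : ℕ) : State :=
  { s with reg := Function.update s.reg d v }

/-- Write `v` into memory cell `m`. -/
def State.setMem (s : State) (m v : ℕ) : State :=
  { s with mem := Function.update s.mem m v }

/-- `Exec p s t s'`: the program `p`, started in `s`, halts in `s'` after exactly `t` steps.
Reading a random bit from an exhausted tape is impossible: the machine is then stuck. -/
inductive Exec : Prog → State → ℕ → State → Prop
  | const (s : State) (d c : ℕ) : Exec (.const d c) s 1 (s.setReg d c)
  | add (s : State) (d a b : ℕ) : Exec (.add d a b) s 1 (s.setReg d (s.reg a + s.reg b))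
  | sub (s : State) (d a b : ℕ) : Exec (.sub d a b) s 1 (s.setReg d (s.reg a - s.reg b))
  | load (s : State) (d a : ℕ) : Exec (.load d a) s 1 (s.setReg d (s.mem (s.reg a)))
  | store (s : State) (a b : ℕ) : Exec (.store a b) s 1 (s.setMem (s.reg a) (s.reg b))
  | coin (s : State) (d : ℕ) (b : Bool) (l : List Bool) (h : s.tape = b :: l) :
      Exec (.coin d) s 1 (State.setReg { s with tape := l } d b.toNat)
  | seq {p q : Prog} {s₀ s₁ s₂ : State} {t u : ℕ} (hp : Exec p s₀ t s₁) (hq : Exec q s₁ u s₂) :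
      Exec (.seq p q) s₀ (t + u) s₂
  | branch_pos {a : ℕ} {p q : Prog} {s s' : State} {t : ℕ} (h : s.reg a ≠ 0)
      (hp : Exec p s t s') : Exec (.branch a p q) s (t + 1) s'
  | branch_zero {a : ℕ} {p q : Prog} {s s' : State} {t : ℕ} (h : s.reg a = 0)
      (hq : Exec q s t s') : Exec (.branch a p q) s (t + 1) s'
  | loop_pos {a : ℕ} {p : Prog} {s₀ s₁ s₂ : State} {t u : ℕ} (h : s₀.reg a ≠ 0)
      (hp : Exec p s₀ t s₁) (hl : Exec (.loop a p) s₁ u s₂) :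
      Exec (.loop a p) s₀ (t + u + 1) s₂
  | loop_zero {a : ℕ} {p : Prog} {s : State} (h : s.reg a = 0) : Exec (.loop a p) s 1 s

/-- The initial configuration on input `N`, `k` with the random bits `ω`: the input is in
registers `0` and `1`; all other registers and the memory are zero. -/
def init (N k : ℕ) {r : ℕ} (ω : Fin r → Bool) : State where
  reg := fun i => if i = 0 then N else if i = 1 then k else 0
  mem := fun _ => 0
  tape := List.ofFn ω

/-- On input `N`, `k` and random bits `ω`, the program `P` halts after at most `T` steps with the
number `Q` in register `0` and the `Q × N` sign matrix `S` in memory, row by row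
(`0` stands for the sign `+1` and every other number for `-1`). -/
def Outputs (P : Prog) (N k : ℕ) {r : ℕ} (ω : Fin r → Bool) (T Q : ℕ)
    (S : Fin Q × Fin N → ℤ) : Prop :=
  ∃ t ≤ T, ∃ s : State, Exec P (init N k ω) t s ∧ s.reg 0 = Q ∧
    ∀ (i : Fin Q) (j : Fin N),
      S (i, j) = if s.mem ((i : ℕ) * N + (j : ℕ)) = 0 then 1 else -1

end RandRAM

/-!
The matrix consists of signs computed by the powering construction of small-bias spaces. Let `K`
be a field with `2^(2h)` elements, `x` and `y` uniform in `K`, and `μ` a nonzero functional to the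
field with two elements. A parity of the bits `μ (y x^i)`, for `i` in a nonempty set of numbers
below `n`, is `μ (y P(x))` with a nonzero polynomial `P` of degree below `n`, so its bias is at
most the probability `n / 2^(2h)` that `x` is a root (`abs_expect_prod_powering_le`). For `h` a
power of three, the polynomial `t^(2h) + t^h + 1` is irreducible modulo two
(`irreducible_cyclotomic_three_pow`), so that no search for a field is needed. Products of elements
of `K` are computed as cyclic convolutions of length `3h`, since the root `ζ` of the polynomial
satisfies `ζ^(3h) = 1`; the resulting vectors are not unique, but the bit `z_0 + z_h` depends only on
the element of `K`.

For the restricted isometry property, fix a `k`-sparse unit vector. The error in the isometry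
property is a quadratic form in the signs, its `p`-th power has coefficients with absolute values
summing to at most `k^p`, and therefore a bias of `(k b)^(-p)` changes its `p`-th moment very
little compared with independent signs (`expect_pow_le_of_biased`). For independent signs, the
exponential moment of the square of a Rademacher sum is bounded one sign at a time
(`sum_exp_sq_le`). With `Q = b² p` rows and Markov's inequality the error exceeds a fixed constant
with probability at most `3 exp (-p)`. A union bound over a net of integer vectors
(`card_sparseIntNet_le`, `hasRIP_of_net`) with `p` a large multiple of `k log (N / k)` proves the
property for all sparse vectors, and with `ℓ = p` the bias `(k²Q/ℓ)^(-ℓ/2)` is exactly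
`(k b)^(-p)`. Logarithms are replaced by the integers `triplings`, which the machine computes by
repeated tripling. The number `h` is of the order of `k log k log (N / k)`, and so is the number
`6h` of random bits. For `k = 1` no random bit is available; then `ε = 1` for `ℓ = Q`, and every
sign matrix preserves the norms of `1`-sparse vectors.
-/

/-! ### A small-bias sign family from powers in a finite field -/

open Polynomial in
/-- The number `2` is a primitive root modulo every power of `3`: its order is even because this
holds modulo `3`, and `2 ^ 2 = 1 + 3` has order `3 ^ l`. -/
theorem orderOf_two_mod_three_pow (l : ℕ) (h : Nat.Coprime 2 (3 ^ (l + 1))) :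
    orderOf (ZMod.unitOfCoprime 2 h) = 2 * 3 ^ l := by
  set u := ZMod.unitOfCoprime 2 h
  have h4 : orderOf (u ^ 2) = 3 ^ l := by
    rw [← orderOf_units, ← ZMod.orderOf_one_add_prime Nat.prime_three (by norm_num) l]
    congr 1
    simp [u]
    norm_num
  have h2 : 2 ∣ orderOf u := by
    have h1 : (2 : ZMod 3) ^ orderOf u = 1 := by
      have h1 := congrArg (fun v => ZMod.castHom (dvd_pow_self 3 (Nat.succ_ne_zero l)) (ZMod 3)
        (Units.val v)) (pow_orderOf_eq_one u)
      simp only [Units.val_pow_eq_pow_val, u, ZMod.coe_unitOfCoprime, map_pow, map_natCast,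
        Units.val_one, map_one] at h1
      exact_mod_cast h1
    have h3 : orderOf (2 : ZMod 3) = 2 :=
      orderOf_eq_prime (by decide) (by decide)
    rw [← h3]
    exact orderOf_dvd_of_pow_eq_one h1
  have h5 := orderOf_pow_of_dvd (x := u) (n := 2) (by norm_num) h2
  omega

open Polynomial in
/-- The polynomial `t^(2h) + t^h + 1` with `h = 3^l` is the cyclotomic polynomial of order
`3^(l+1)`, and it is irreducible over the field with two elements because `2` is a primitive root
modulo `3^(l+1)`. -/
theorem irreducible_cyclotomic_three_pow (l : ℕ) :
    Irreducible (cyclotomic (3 ^ (l + 1)) (ZMod 2)) := by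
  have h2 : ¬ 2 ∣ 3 ^ (l + 1) := fun hd => by
    have := Nat.prime_two.dvd_of_dvd_pow hd
    omega
  refine ZMod.irreducible_of_dvd_cyclotomic_of_natDegree h2 dvd_rfl ?_
  rw [orderOf_two_mod_three_pow, natDegree_cyclotomic,
    Nat.totient_prime_pow Nat.prime_three (Nat.succ_pos l)]
  simp [mul_comm]

open Polynomial in
/-- The field `K` of order `2^(2h)`, with `h = 3^l`, its generator `ζ`, and the functional `μ` that
adds the coordinates number `0` and `h` of an element. The formula for `μ (ζ ^ c)` also holds for
`2h ≤ c < 3h`, where `ζ ^ c` is not a basis element, so `μ` can be read off from any of the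
redundant coordinate vectors of length `3h`. -/
theorem exists_field_with_root (l : ℕ) :
    ∃ (K : Type) (_ : Field K) (_ : Fintype K) (_ : Algebra (ZMod 2) K) (ζ : K)
      (μ : K →ₗ[ZMod 2] ZMod 2),
      Fintype.card K = 2 ^ (2 * 3 ^ l) ∧ ζ ^ (3 * 3 ^ l) = 1 ∧
      (∀ c < 3 * 3 ^ l, μ (ζ ^ c) = if c = 0 ∨ c = 3 ^ l then 1 else 0) ∧
      ∀ a : K, ∃ v : Fin (3 * 3 ^ l) → ZMod 2, ∑ i, v i • ζ ^ (i : ℕ) = a := by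
  set f := cyclotomic (3 ^ (l + 1)) (ZMod 2) with hf
  have hirr : Irreducible f := irreducible_cyclotomic_three_pow l
  have : Fact (Irreducible f) := ⟨hirr⟩
  obtain ⟨h, hh⟩ : ∃ h, 3 ^ l = h := ⟨_, rfl⟩
  have hpos : 0 < h := hh ▸ (by positivity)
  rw [hh]
  have hf' : f = X ^ (2 * h) + X ^ h + 1 := by
    rw [hf, cyclotomic_prime_pow_eq_geom_sum Nat.prime_three]
    simp [Finset.sum_range_succ, hh]
    ring
  have hmonic : f.Monic := cyclotomic.monic _ _
  have hdeg : f.natDegree = 2 * h := by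
    rw [hf, natDegree_cyclotomic, Nat.totient_prime_pow Nat.prime_three (Nat.succ_pos l)]
    simp [mul_comm, hh]
  have hfin := hmonic.finite_adjoinRoot
  have : Finite (AdjoinRoot f) := Module.finite_of_finite (ZMod 2)
  let pB := AdjoinRoot.powerBasis' hmonic
  have hdim : pB.dim = 2 * h := by simp [pB, hdeg]
  have hgen : pB.gen = AdjoinRoot.root f := by simp [pB]
  set ζ := AdjoinRoot.root f with hζ
  have hrel : ζ ^ (2 * h) + ζ ^ h + 1 = 0 := by
    have h1 : aeval ζ f = 0 := by rw [AdjoinRoot.aeval_eq, AdjoinRoot.mk_self]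
    have h2 : aeval ζ f = aeval ζ (X ^ (2 * h) + X ^ h + 1 : (ZMod 2)[X]) := congrArg _ hf'
    rw [← h1, h2]
    simp
  have hone : ζ ^ (3 * h) = 1 := by
    have : (ζ ^ h - 1) * (ζ ^ (2 * h) + ζ ^ h + 1) = 0 := by rw [hrel, mul_zero]
    have h3 : (ζ ^ h - 1) * (ζ ^ (2 * h) + ζ ^ h + 1) = ζ ^ (3 * h) - 1 := by ring
    rw [h3] at this
    exact sub_eq_zero.mp this
  have hbas : ∀ i (hi : i < 2 * h), pB.basis ⟨i, by omega⟩ = ζ ^ i := by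
    intro i hi
    simp [PowerBasis.coe_basis, hgen]
  let μ : AdjoinRoot f →ₗ[ZMod 2] ZMod 2 :=
    pB.basis.coord ⟨0, by omega⟩ + pB.basis.coord ⟨h, by omega⟩
  have hμ : ∀ c < 2 * h, μ (ζ ^ c) = if c = 0 ∨ c = h then 1 else 0 := by
    intro c hc
    have h0h : 0 ≠ h := by omega
    rw [← hbas c hc]
    simp only [μ, LinearMap.add_apply, Module.Basis.coord_apply, Module.Basis.repr_self,
      Finsupp.single_apply, Fin.mk.injEq]
    by_cases h1 : c = 0
    · subst h1; simp [h0h]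
    · simp [h1]
  let hft : Fintype (AdjoinRoot f) := Fintype.ofFinite _
  refine ⟨AdjoinRoot f, inferInstance, hft, inferInstance, ζ, μ, ?_, hone, ?_, ?_⟩
  · rw [← Nat.card_eq_fintype_card, Module.natCard_eq_pow_finrank (K := ZMod 2), pB.finrank, hdim]
    simp
  · intro c hc
    rcases lt_or_ge c (2 * h) with h1 | h1
    · exact hμ c h1
    · obtain ⟨d, rfl⟩ := Nat.exists_eq_add_of_le h1
      -- in characteristic two, `ζ^(2h) = ζ^h + 1`
      have h2 : ζ ^ (2 * h + d) = -ζ ^ (d + h) - ζ ^ d := by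
        linear_combination ζ ^ d * hrel
      rw [h2, map_sub, map_neg, hμ _ (by omega), hμ _ (by omega)]
      by_cases hd : d = 0
      · subst hd
        rw [if_pos (by omega), if_pos (by omega), if_neg (by omega)]
        decide
      · rw [if_neg (by omega), if_neg (by omega), if_neg (by omega)]
        simp
  · intro a
    refine ⟨fun i => if hi : (i : ℕ) < 2 * h then pB.basis.repr a ⟨i, by omega⟩ else 0, ?_⟩
    have hs := pB.basis.sum_repr a
    rw [← Fin.sum_congr' _ hdim.symm] at hs
    have key := Fin.sum_univ_eq_sum_range
      (fun i => (if hi : i < 2 * h then pB.basis.repr a ⟨i, by omega⟩ else 0) • ζ ^ i) (3 * h)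
    rw [key, show 3 * h = 2 * h + h by ring, Finset.sum_range_add]
    rw [Finset.sum_eq_zero (s := Finset.range h) (fun i _ => by simp), add_zero,
      ← Fin.sum_univ_eq_sum_range]
    conv_rhs => rw [← hs]
    refine Finset.sum_congr rfl fun i _ => ?_
    rw [dif_pos i.2, ← hbas i i.2]
    rfl

/-- A surjective homomorphism of finite groups maps the uniform distribution to the uniform
distribution. -/
theorem expect_comp_of_surjective {G H : Type*} [AddCommGroup G] [AddCommGroup H] [Fintype G]
    [Fintype H] (φ : G →+ H) (hφ : Function.Surjective φ) (f : H → ℝ) :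
    Finset.expect Finset.univ (fun g => f (φ g)) = Finset.expect Finset.univ f := by
  have h1 : ∀ h : H, Finset.expect Finset.univ (fun g => f (φ g + h)) =
      Finset.expect Finset.univ (fun g => f (φ g)) := by
    intro h
    obtain ⟨g₀, rfl⟩ := hφ h
    exact Fintype.expect_equiv (Equiv.addRight g₀) _ _ (fun g => by simp)
  have h2 : ∀ g : G, Finset.expect Finset.univ (fun h => f (φ g + h)) =
      Finset.expect Finset.univ f := fun g =>
    Fintype.expect_equiv (Equiv.addLeft (φ g)) _ _ (fun h => by simp)
  calc _ = Finset.expect Finset.univ (fun _ : H =>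
        Finset.expect Finset.univ (fun g => f (φ g))) := by simp
    _ = Finset.expect Finset.univ (fun h : H =>
        Finset.expect Finset.univ (fun g => f (φ g + h))) := by simp_rw [h1]
    _ = Finset.expect Finset.univ (fun g : G =>
        Finset.expect Finset.univ (fun h => f (φ g + h))) := Finset.expect_comm _ _ _
    _ = _ := by simp_rw [h2]; simp

/-- The nontrivial character of the group with two elements, with integer values. -/
def bitSign (a : ZMod 2) : ℤ := if a = 0 then 1 else -1

theorem bitSign_add : ∀ a b : ZMod 2, bitSign (a + b) = bitSign a * bitSign b := by decide

theorem prod_bitSign {ι : Type*} (y : Finset ι) (g : ι → ZMod 2) :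
    ∏ i ∈ y, bitSign (g i) = bitSign (∑ i ∈ y, g i) := by
  classical
  induction y using Finset.induction_on with
  | empty => simp [bitSign]
  | insert i y hi ih => rw [Finset.prod_insert hi, Finset.sum_insert hi, bitSign_add, ih]

section
variable {K : Type} [Field K] [Fintype K] [Algebra (ZMod 2) K]

theorem sum_bitSign_mul_eq_zero (μ : K →ₗ[ZMod 2] ZMod 2) (hμ : ∃ a, μ a = 1) {w : K}
    (hw : w ≠ 0) : ∑ y : K, (bitSign (μ (y * w)) : ℝ) = 0 := by
  obtain ⟨a, ha⟩ := hμ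
  have h : ∑ y : K, (bitSign (μ (y * w)) : ℝ) = ∑ y : K, -(bitSign (μ (y * w)) : ℝ) := by
    refine Fintype.sum_equiv (Equiv.addRight (a * w⁻¹)) _ _ fun y => ?_
    simp only [Equiv.coe_addRight, add_mul, map_add, mul_assoc, inv_mul_cancel₀ hw, mul_one, ha,
      bitSign_add]
    simp [bitSign]
  rw [Finset.sum_neg_distrib] at h
  linarith

open Polynomial in
/-- The powering construction: for uniform `x` and `y` in a finite field of characteristic two, a
parity of the bits `μ (y * x ^ e i)` is unbiased unless `x` is a root of a fixed nonzero
polynomial of degree less than `n`. -/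
theorem abs_expect_prod_powering_le (μ : K →ₗ[ZMod 2] ZMod 2) (hμ : ∃ a, μ a = 1) {ι : Type*}
    (e : ι → ℕ) (he : Function.Injective e) (n : ℕ) (hn : ∀ i, e i < n) (U : Finset ι)
    (hU : U.Nonempty) :
    |Finset.expect Finset.univ
      (fun xy : K × K => ∏ i ∈ U, (bitSign (μ (xy.2 * xy.1 ^ e i)) : ℝ))| ≤
      n / Fintype.card K := by
  classical
  set P : K[X] := ∑ i ∈ U, X ^ e i with hP
  have hcoeff : ∀ j ∈ U, P.coeff (e j) = 1 := by
    intro j hj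
    simp [hP, coeff_X_pow, he.eq_iff, hj]
  have hP0 : P ≠ 0 := by
    obtain ⟨j, hj⟩ := hU
    intro h0
    have := hcoeff j hj
    simp [h0] at this
  have hdeg : P.natDegree ≤ n := by
    refine natDegree_sum_le_of_forall_le _ _ fun i _ => ?_
    simpa using (hn i).le
  have hprod : ∀ x y : K, ∏ i ∈ U, (bitSign (μ (y * x ^ e i)) : ℝ) =
      bitSign (μ (y * P.eval x)) := by
    intro x y
    rw [← Int.cast_prod, prod_bitSign, ← map_sum, hP, eval_finsetSum, Finset.mul_sum]
    simp
  have hroots : ((Finset.univ.filter fun x : K => P.eval x = 0).card : ℝ) ≤ n := by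
    have h1 : (Finset.univ.filter fun x : K => P.eval x = 0) ⊆ P.roots.toFinset := by
      intro x hx
      simpa [hP0] using hx
    exact_mod_cast (Finset.card_le_card h1).trans
      ((Multiset.toFinset_card_le _).trans ((card_roots' P).trans hdeg))
  have hsum : ∑ xy : K × K, ∏ i ∈ U, (bitSign (μ (xy.2 * xy.1 ^ e i)) : ℝ) =
      (Finset.univ.filter fun x : K => P.eval x = 0).card * Fintype.card K := by
    rw [Fintype.sum_prod_type, Finset.card_filter]
    push_cast
    rw [Finset.sum_mul]
    refine Finset.sum_congr rfl fun x _ => ?_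
    simp_rw [hprod]
    by_cases hx : P.eval x = 0
    · simp [hx, bitSign]
    · rw [sum_bitSign_mul_eq_zero μ hμ hx]
      simp [hx]
  have hK : (0 : ℝ) < Fintype.card K := by exact_mod_cast Fintype.card_pos
  rw [Fintype.expect_eq_sum_div_card, hsum, Fintype.card_prod, abs_of_nonneg (by positivity)]
  push_cast
  rw [mul_div_mul_right _ _ hK.ne']
  gcongr

end

/-! ### Moments of a quadratic form in signs of small bias -/

/-- The sign of a bit, as a real number. -/
def realSign (b : Bool) : ℝ := if b then -1 else 1

theorem realSign_mul_self (b : Bool) : realSign b * realSign b = 1 := by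
  cases b <;> simp [realSign]

/-- A product of parities is a parity, by symmetric differences. -/
theorem exists_prod_prod_eq_prod {ι β : Type*} (t : Finset β) (g : β → Finset ι) :
    ∃ Y : Finset ι, ∀ s : ι → ℝ, (∀ i, s i * s i = 1) →
      ∏ j ∈ t, ∏ i ∈ g j, s i = ∏ i ∈ Y, s i := by
  classical
  induction t using Finset.induction_on with
  | empty => exact ⟨∅, fun s _ => by simp⟩
  | insert j t hj ih =>
    obtain ⟨Y, hY⟩ := ih
    refine ⟨symmDiff (g j) Y, fun s hs => ?_⟩
    have hone : (∏ i ∈ g j ∩ Y, s i) * (∏ i ∈ g j ∩ Y, s i) = 1 := by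
      rw [← Finset.prod_mul_distrib]
      exact Finset.prod_eq_one fun i _ => hs i
    have h1 : ∏ i ∈ g j, s i = (∏ i ∈ g j \ Y, s i) * ∏ i ∈ g j ∩ Y, s i := by
      rw [mul_comm, Finset.prod_inter_mul_prod_sdiff]
    have h2 : ∏ i ∈ Y, s i = (∏ i ∈ Y \ g j, s i) * ∏ i ∈ g j ∩ Y, s i := by
      rw [mul_comm, Finset.inter_comm, Finset.prod_inter_mul_prod_sdiff]
    rw [Finset.prod_insert hj, hY s hs, h1, h2, symmDiff_def, Finset.sup_eq_union,
      Finset.prod_union disjoint_sdiff_sdiff]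
    linear_combination ((∏ i ∈ g j \ Y, s i) * (∏ i ∈ Y \ g j, s i)) * hone

theorem expect_prod_realSign {ι : Type*} [Fintype ι] [DecidableEq ι] (Y : Finset ι) (hY : Y.Nonempty) :
    Finset.expect Finset.univ (fun σ : ι → Bool => ∏ i ∈ Y, realSign (σ i)) = 0 := by
  obtain ⟨i₀, hi₀⟩ := hY
  -- flipping one coordinate in `Y` changes the sign of the product
  let flip : (ι → Bool) → (ι → Bool) := fun σ => Function.update σ i₀ (!(σ i₀))
  have hflip : Function.Involutive flip := by
    intro σ
    simp [flip]
  have h : Finset.expect Finset.univ (fun σ : ι → Bool => ∏ i ∈ Y, realSign (σ i)) =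
      Finset.expect Finset.univ (fun σ : ι → Bool => -∏ i ∈ Y, realSign (σ i)) := by
    refine Fintype.expect_equiv hflip.toPerm _ _ fun σ => ?_
    have h1 : ∏ i ∈ Y.erase i₀, realSign (flip σ i) = ∏ i ∈ Y.erase i₀, realSign (σ i) :=
      Finset.prod_congr rfl fun i hi => by simp [flip, Finset.ne_of_mem_erase hi]
    change _ = -∏ i ∈ Y, realSign (flip σ i)
    rw [← Finset.mul_prod_erase Y _ hi₀, ← Finset.mul_prod_erase Y _ hi₀, h1]
    have h2 : realSign (flip σ i₀) = -realSign (σ i₀) := by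
      simp only [flip, Function.update_self]
      cases σ i₀ <;> simp [realSign]
    rw [h2]
    ring
  rw [Finset.expect_neg_distrib] at h
  linarith

/-- A moment of a multilinear polynomial in signs of bias at most `ε` exceeds the same moment for
independent uniform signs by at most `ε` times the corresponding power of the sum of the absolute
values of the coefficients: the power expands into monomials, each of which is a parity. -/
theorem expect_pow_le_of_biased {Ω ι α : Type*} [Fintype Ω] [Nonempty Ω] [Fintype ι]
    [DecidableEq ι] [Fintype α] (S : Ω → ι → ℤ) (hS : ∀ ω i, S ω i = 1 ∨ S ω i = -1) (ε : ℝ)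
    (hε : 0 ≤ ε)
    (hbias : ∀ y : Finset ι, y.Nonempty →
      |Finset.expect Finset.univ (fun ω => ∏ i ∈ y, (S ω i : ℝ))| ≤ ε)
    (c : α → ℝ) (y : α → Finset ι) (p : ℕ) :
    Finset.expect Finset.univ (fun ω => (∑ a, c a * ∏ i ∈ y a, (S ω i : ℝ)) ^ p) ≤
      Finset.expect Finset.univ
        (fun σ : ι → Bool => (∑ a, c a * ∏ i ∈ y a, realSign (σ i)) ^ p) +
      ε * (∑ a, |c a|) ^ p := by
  choose Y hY using fun f : Fin p → α =>
    exists_prod_prod_eq_prod (Finset.univ : Finset (Fin p)) (fun j => y (f j))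
  have hexp : ∀ s : ι → ℝ, (∀ i, s i * s i = 1) → (∑ a, c a * ∏ i ∈ y a, s i) ^ p =
      ∑ f : Fin p → α, (∏ j, c (f j)) * ∏ i ∈ Y f, s i := by
    intro s hs
    rw [Fintype.sum_pow]
    refine Finset.sum_congr rfl fun f _ => ?_
    rw [Finset.prod_mul_distrib, hY f s hs]
  have habs : (∑ a, |c a|) ^ p = ∑ f : Fin p → α, |∏ j, c (f j)| := by
    rw [Fintype.sum_pow]
    exact Finset.sum_congr rfl fun f _ => (Finset.abs_prod _ _).symm
  have hS' : ∀ ω i, (S ω i : ℝ) * S ω i = 1 := by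
    intro ω i
    rcases hS ω i with h | h <;> simp [h]
  have e1 : Finset.expect Finset.univ (fun ω => (∑ a, c a * ∏ i ∈ y a, (S ω i : ℝ)) ^ p) =
      ∑ f : Fin p → α, (∏ j, c (f j)) *
        Finset.expect Finset.univ (fun ω => ∏ i ∈ Y f, (S ω i : ℝ)) := by
    simp_rw [fun ω => hexp (fun i => (S ω i : ℝ)) (hS' ω)]
    rw [Finset.expect_sum_comm]
    simp_rw [Finset.mul_expect]
  have e2 : Finset.expect Finset.univ
        (fun σ : ι → Bool => (∑ a, c a * ∏ i ∈ y a, realSign (σ i)) ^ p) =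
      ∑ f : Fin p → α, (∏ j, c (f j)) *
        Finset.expect Finset.univ (fun σ : ι → Bool => ∏ i ∈ Y f, realSign (σ i)) := by
    simp_rw [fun σ : ι → Bool =>
      hexp (fun i => realSign (σ i)) (fun i => realSign_mul_self _)]
    rw [Finset.expect_sum_comm]
    simp_rw [Finset.mul_expect]
  rw [e1, e2, habs, Finset.mul_sum, ← Finset.sum_add_distrib]
  refine Finset.sum_le_sum fun f _ => ?_
  rcases (Y f).eq_empty_or_nonempty with h | h
  · simp only [h, Finset.prod_empty, Finset.expect_const Finset.univ_nonempty]
    have := mul_nonneg hε (abs_nonneg (∏ j, c (f j)))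
    linarith
  · rw [expect_prod_realSign _ h, mul_zero, zero_add, mul_comm ε]
    calc _ ≤ |(∏ j, c (f j)) * Finset.expect Finset.univ (fun ω => ∏ i ∈ Y f, (S ω i : ℝ))| :=
          le_abs_self _
      _ ≤ _ := by
          rw [abs_mul]
          exact mul_le_mul_of_nonneg_left (hbias _ h) (abs_nonneg _)

/-- Exponential moments of the square of a Rademacher sum, for exponents `τ` of either sign.
Averaging over one sign turns `τ` into `τ + 2 τ² x²`, because `cosh u ≤ exp (u² / 2)`. -/
theorem sum_exp_sq_le {n : ℕ} (x : Fin n → ℝ) (τ U R a : ℝ) (h1 : -R ≤ τ)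
    (h2 : τ + 2 * R ^ 2 * ∑ j, x j ^ 2 ≤ U) (h3 : U ≤ R) :
    ∑ σ : Fin n → Bool, Real.exp (τ * (a + ∑ j, realSign (σ j) * x j) ^ 2) ≤
      2 ^ n * Real.exp (U * (a ^ 2 + ∑ j, x j ^ 2)) := by
  induction n generalizing τ with
  | zero =>
    simp only [Finset.univ_eq_empty, Finset.sum_empty, mul_zero, add_zero] at h2
    simp only [Finset.univ_unique, Finset.univ_eq_empty, Finset.sum_empty, add_zero,
      Finset.sum_singleton, pow_zero, one_mul]
    gcongr
  | succ n ih =>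
    set V := ∑ j : Fin n, x j.succ ^ 2 with hV
    have hV0 : 0 ≤ V := Finset.sum_nonneg fun j _ => sq_nonneg _
    rw [Fin.sum_univ_succ, ← hV] at h2 ⊢
    have hx0 := sq_nonneg (x 0)
    have hτU : τ ≤ U := by
      have : 0 ≤ 2 * R ^ 2 * (x 0 ^ 2 + V) := by positivity
      linarith
    have hτR : τ ^ 2 ≤ R ^ 2 := sq_le_sq' h1 (hτU.trans h3)
    have hstep := ih (fun j => x j.succ) (τ + 2 * τ ^ 2 * x 0 ^ 2)
      (by have := mul_nonneg (sq_nonneg τ) hx0; linarith)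
      (by have := mul_le_mul_of_nonneg_right hτR hx0; linarith)
    have hone : ∀ g : ℝ, Real.exp (τ * (a + (realSign true * x 0 + g)) ^ 2) +
        Real.exp (τ * (a + (realSign false * x 0 + g)) ^ 2) ≤
        2 * Real.exp (τ * x 0 ^ 2) * Real.exp ((τ + 2 * τ ^ 2 * x 0 ^ 2) * (a + g) ^ 2) := by
      intro g
      have hc := Real.cosh_le_exp_half_sq (2 * τ * (a + g) * x 0)
      rw [Real.cosh_eq] at hc
      have e1 : Real.exp (τ * (a + (realSign true * x 0 + g)) ^ 2) =
          Real.exp (τ * (a + g) ^ 2 + τ * x 0 ^ 2) * Real.exp (-(2 * τ * (a + g) * x 0)) := by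
        rw [← Real.exp_add]; congr 1; simp [realSign]; ring
      have e2 : Real.exp (τ * (a + (realSign false * x 0 + g)) ^ 2) =
          Real.exp (τ * (a + g) ^ 2 + τ * x 0 ^ 2) * Real.exp (2 * τ * (a + g) * x 0) := by
        rw [← Real.exp_add]; congr 1; simp [realSign]; ring
      have e3 : 2 * Real.exp (τ * x 0 ^ 2) *
          Real.exp ((τ + 2 * τ ^ 2 * x 0 ^ 2) * (a + g) ^ 2) =
          Real.exp (τ * (a + g) ^ 2 + τ * x 0 ^ 2) *
            (2 * Real.exp ((2 * τ * (a + g) * x 0) ^ 2 / 2)) := by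
        rw [mul_assoc, ← Real.exp_add, mul_left_comm, ← Real.exp_add]
        congr 2; ring
      rw [e1, e2, e3, ← mul_add]
      refine mul_le_mul_of_nonneg_left ?_ (Real.exp_pos _).le
      linarith
    have hsplit : ∑ σ : Fin (n + 1) → Bool,
        Real.exp (τ * (a + ∑ j, realSign (σ j) * x j) ^ 2) =
        ∑ ρ : Fin n → Bool,
          (Real.exp (τ * (a + (realSign true * x 0 + ∑ j, realSign (ρ j) * x j.succ)) ^ 2) +
          Real.exp (τ * (a + (realSign false * x 0 + ∑ j, realSign (ρ j) * x j.succ)) ^ 2)) := by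
      rw [← (Fin.consEquiv fun _ => Bool).sum_comp, Fintype.sum_prod_type, Fintype.sum_bool,
        ← Finset.sum_add_distrib]
      refine Finset.sum_congr rfl fun ρ _ => ?_
      simp [Fin.consEquiv, Fin.sum_univ_succ]
    rw [hsplit]
    calc _ ≤ ∑ ρ : Fin n → Bool, 2 * Real.exp (τ * x 0 ^ 2) *
          Real.exp ((τ + 2 * τ ^ 2 * x 0 ^ 2) * (a + ∑ j, realSign (ρ j) * x j.succ) ^ 2) :=
          Finset.sum_le_sum fun ρ _ => hone _
      _ ≤ 2 * Real.exp (τ * x 0 ^ 2) * (2 ^ n * Real.exp (U * (a ^ 2 + V))) := by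
          rw [← Finset.mul_sum]
          gcongr
      _ ≤ 2 * Real.exp (U * x 0 ^ 2) * (2 ^ n * Real.exp (U * (a ^ 2 + V))) := by
          gcongr
      _ = _ := by
          rw [show U * (a ^ 2 + (x 0 ^ 2 + V)) = U * x 0 ^ 2 + U * (a ^ 2 + V) by ring,
            Real.exp_add]
          ring

theorem sum_exp_sq_sub_one_le {n : ℕ} (x : Fin n → ℝ) (hx : ∑ j, x j ^ 2 = 1) (τ : ℝ)
    (hτ : |τ| ≤ 1 / 8) :
    ∑ σ : Fin n → Bool, Real.exp (τ * ((∑ j, realSign (σ j) * x j) ^ 2 - 1)) ≤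
      2 ^ n * Real.exp (8 * τ ^ 2) := by
  obtain ⟨hl, hu⟩ := abs_le.mp hτ
  have key : ∑ σ : Fin n → Bool, Real.exp (τ * (0 + ∑ j, realSign (σ j) * x j) ^ 2) ≤
      2 ^ n * Real.exp ((τ + 8 * τ ^ 2) * (0 ^ 2 + ∑ j, x j ^ 2)) := by
    rcases le_total 0 τ with h0 | h0
    · refine sum_exp_sq_le x τ _ (τ + 8 * τ ^ 2) 0 (by nlinarith) ?_ le_rfl
      rw [hx]
      have : τ + 8 * τ ^ 2 ≤ 2 * τ := by nlinarith
      have : (τ + 8 * τ ^ 2) ^ 2 ≤ (2 * τ) ^ 2 := pow_le_pow_left₀ (by positivity) this 2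
      nlinarith
    · refine sum_exp_sq_le x τ _ (-τ) 0 (by linarith) ?_ (by nlinarith)
      rw [hx]
      nlinarith
  rw [hx] at key
  calc _ = ∑ σ : Fin n → Bool,
        Real.exp (-τ) * Real.exp (τ * (0 + ∑ j, realSign (σ j) * x j) ^ 2) := by
        refine Finset.sum_congr rfl fun σ _ => ?_
        rw [← Real.exp_add]; congr 1; ring
    _ ≤ Real.exp (-τ) * (2 ^ n * Real.exp ((τ + 8 * τ ^ 2) * (0 ^ 2 + 1))) := by
        rw [← Finset.mul_sum]
        gcongr
    _ = _ := by
        rw [mul_left_comm, ← Real.exp_add]; congr 2; ring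

/-- The sum over the rows `q` of `⟨row, x⟩² - 1` for a matrix of signs; for a unit vector `x` it
is `Q` times the error in the isometry property. -/
def isometryError {Q N : ℕ} (x : Fin N → ℝ) (s : Fin Q × Fin N → ℝ) : ℝ :=
  ∑ q, ((∑ j, s (q, j) * x j) ^ 2 - 1)

theorem expect_exp_isometryError_le {Q N : ℕ} (x : Fin N → ℝ) (hx : ∑ j, x j ^ 2 = 1) (τ : ℝ)
    (hτ : |τ| ≤ 1 / 8) :
    Finset.expect Finset.univ (fun σ : Fin Q × Fin N → Bool =>
      Real.exp (τ * isometryError x (fun i => realSign (σ i)))) ≤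
      Real.exp (8 * τ ^ 2 * Q) := by
  classical
  have h1 : ∑ σ : Fin Q × Fin N → Bool,
      Real.exp (τ * isometryError x (fun i => realSign (σ i))) =
      (∑ ρ : Fin N → Bool, Real.exp (τ * ((∑ j, realSign (ρ j) * x j) ^ 2 - 1))) ^ Q := by
    rw [Fintype.sum_pow, ← (Equiv.curry (Fin Q) (Fin N) Bool).symm.sum_comp]
    refine Finset.sum_congr rfl fun σ _ => ?_
    rw [isometryError, Finset.mul_sum, Real.exp_sum]
    rfl
  rw [Fintype.expect_eq_sum_div_card, h1, div_le_iff₀ (by positivity)]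
  calc _ ≤ (2 ^ N * Real.exp (8 * τ ^ 2)) ^ Q := by
        gcongr
        exact sum_exp_sq_sub_one_le x hx τ hτ
    _ = _ := by
        rw [mul_pow, ← Real.exp_nat_mul, mul_comm (Real.exp _)]
        simp only [Fintype.card_pi, Fintype.card_bool, Finset.prod_const, Finset.card_univ,
          Fintype.card_prod, Fintype.card_fin]
        rw [← pow_mul, mul_comm N Q, mul_comm (Q : ℝ)]
        push_cast
        rfl

/-- The moments of the error for independent signs, from the exponential moments at `± 1 / b`. -/
theorem expect_isometryError_pow_le {N : ℕ} (x : Fin N → ℝ) (hx : ∑ j, x j ^ 2 = 1) (b p : ℕ)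
    (hb : 8 ≤ b) (hp : Even p) :
    Finset.expect Finset.univ (fun σ : Fin (b ^ 2 * p) × Fin N → Bool =>
      isometryError x (fun i => realSign (σ i)) ^ p) ≤ 2 * (p * b * Real.exp 8) ^ p := by
  have hb0 : (0 : ℝ) < b := by positivity
  have hb8 : (8 : ℝ) ≤ b := by exact_mod_cast hb
  have hτ : |(b : ℝ)⁻¹| ≤ 1 / 8 := by
    rw [abs_of_pos (by positivity), one_div]
    gcongr
  have hpt : ∀ w : ℝ, w ^ p ≤ (p * b : ℝ) ^ p *
      (Real.exp ((b : ℝ)⁻¹ * w) + Real.exp (-(b : ℝ)⁻¹ * w)) := by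
    intro w
    have h1 : ((b : ℝ)⁻¹ * |w|) ^ p / p.factorial ≤ Real.exp ((b : ℝ)⁻¹ * |w|) :=
      Real.pow_div_factorial_le_exp _ (by positivity) p
    have h2 : Real.exp ((b : ℝ)⁻¹ * |w|) ≤
        Real.exp ((b : ℝ)⁻¹ * w) + Real.exp (-(b : ℝ)⁻¹ * w) := by
      rcases abs_cases w with ⟨h, _⟩ | ⟨h, _⟩ <;> rw [h]
      · have := Real.exp_pos (-(b : ℝ)⁻¹ * w); linarith
      · have := Real.exp_pos ((b : ℝ)⁻¹ * w)
        rw [neg_mul, mul_neg] at *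
        linarith
    have h3 : (p.factorial : ℝ) ≤ (p : ℝ) ^ p := by exact_mod_cast Nat.factorial_le_pow p
    rw [div_le_iff₀ (by positivity), mul_pow, inv_pow, hp.pow_abs] at h1
    rw [mul_pow]
    have h4 : w ^ p = (b : ℝ) ^ p * (((b : ℝ) ^ p)⁻¹ * w ^ p) := by
      field_simp
    rw [h4]
    calc _ ≤ (b : ℝ) ^ p * (Real.exp ((b : ℝ)⁻¹ * |w|) * p.factorial) :=
          mul_le_mul_of_nonneg_left h1 (by positivity)
      _ ≤ (b : ℝ) ^ p * ((Real.exp ((b : ℝ)⁻¹ * w) + Real.exp (-(b : ℝ)⁻¹ * w)) * (p : ℝ) ^ p) := by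
          gcongr
      _ = _ := by ring
  have hQ : 8 * (b : ℝ)⁻¹ ^ 2 * ((b ^ 2 * p : ℕ) : ℝ) = p * 8 := by
    push_cast
    field_simp
  have e1 := expect_exp_isometryError_le (Q := b ^ 2 * p) x hx _ hτ
  have e2 := expect_exp_isometryError_le (Q := b ^ 2 * p) x hx (-(b : ℝ)⁻¹) (by rwa [abs_neg])
  rw [neg_sq] at e2
  rw [hQ, Real.exp_nat_mul] at e1 e2
  calc _ ≤ Finset.expect Finset.univ (fun σ : Fin (b ^ 2 * p) × Fin N → Bool =>
        (p * b : ℝ) ^ p *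
          (Real.exp ((b : ℝ)⁻¹ * isometryError x (fun i => realSign (σ i))) +
            Real.exp (-(b : ℝ)⁻¹ * isometryError x (fun i => realSign (σ i))))) :=
        Finset.expect_le_expect fun σ _ => hpt _
    _ ≤ (p * b : ℝ) ^ p * (Real.exp 8 ^ p + Real.exp 8 ^ p) := by
        rw [← Finset.mul_expect, Finset.expect_add_distrib]
        gcongr
    _ = _ := by rw [mul_pow _ (Real.exp 8)]; ring

theorem isometryError_eq_sum {Q N : ℕ} (x : Fin N → ℝ) (hx : ∑ j, x j ^ 2 = 1)
    (s : Fin Q × Fin N → ℝ) (hs : ∀ i, s i * s i = 1) :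
    isometryError x s = ∑ a : Fin Q × Fin N × Fin N,
      (if a.2.1 = a.2.2 then 0 else x a.2.1 * x a.2.2) *
        ∏ i ∈ ({(a.1, a.2.1), (a.1, a.2.2)} : Finset (Fin Q × Fin N)), s i := by
  rw [Fintype.sum_prod_type, isometryError]
  refine Finset.sum_congr rfl fun q _ => ?_
  rw [Fintype.sum_prod_type, sq, Finset.sum_mul_sum, ← hx, ← Finset.sum_sub_distrib]
  refine Finset.sum_congr rfl fun i _ => ?_
  have h : ∀ j, (if i = j then 0 else x i * x j) *
      ∏ l ∈ ({(q, i), (q, j)} : Finset (Fin Q × Fin N)), s l =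
      s (q, i) * x i * (s (q, j) * x j) - if i = j then x i ^ 2 else 0 := by
    intro j
    by_cases hij : i = j
    · subst hij
      simp only [if_true, zero_mul]
      linear_combination -(x i ^ 2) * hs (q, i)
    · rw [if_neg hij, if_neg hij, Finset.prod_pair (by simpa using hij)]
      ring
  simp_rw [h]
  rw [Finset.sum_sub_distrib]
  simp

/-- The moment bound for signs of bias at most `(k b)^(-p)`. -/
theorem expect_biased_isometryError_pow_le {Ω : Type*} [Fintype Ω] [Nonempty Ω] {N k b p : ℕ}
    (hk : 1 ≤ k) (hb : 8 ≤ b) (hp : Even p)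
    (S : Ω → Fin (b ^ 2 * p) × Fin N → ℤ) (hS : ∀ ω i, S ω i = 1 ∨ S ω i = -1)
    (hbias : ∀ y : Finset (Fin (b ^ 2 * p) × Fin N), y.Nonempty →
      |Finset.expect Finset.univ (fun ω => ∏ i ∈ y, (S ω i : ℝ))| ≤ (((k : ℝ) * b) ^ p)⁻¹)
    (x : Fin N → ℝ) (hx : ∑ j, x j ^ 2 = 1) (hx1 : (∑ j, |x j|) ^ 2 ≤ k) :
    Finset.expect Finset.univ (fun ω => isometryError x (fun i => (S ω i : ℝ)) ^ p) ≤
      3 * (p * b * Real.exp 8) ^ p := by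
  have hb0 : (0 : ℝ) < b := by positivity
  have hk0 : (0 : ℝ) < k := by positivity
  have hS' : ∀ ω i, (S ω i : ℝ) * S ω i = 1 := by
    intro ω i
    rcases hS ω i with h | h <;> simp [h]
  have h1 := expect_pow_le_of_biased S hS _ (by positivity) hbias
    (fun a : Fin (b ^ 2 * p) × Fin N × Fin N =>
      if a.2.1 = a.2.2 then 0 else x a.2.1 * x a.2.2)
    (fun a => ({(a.1, a.2.1), (a.1, a.2.2)} : Finset (Fin (b ^ 2 * p) × Fin N))) p
  simp_rw [← fun ω => isometryError_eq_sum x hx (fun i => (S ω i : ℝ)) (hS' ω),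
    ← fun σ : Fin (b ^ 2 * p) × Fin N → Bool => isometryError_eq_sum x hx
      (fun i => realSign (σ i)) (fun i => realSign_mul_self _)] at h1
  refine h1.trans ?_
  have h2 := expect_isometryError_pow_le x hx b p hb hp
  have h3 : ∑ a : Fin (b ^ 2 * p) × Fin N × Fin N,
      |if a.2.1 = a.2.2 then 0 else x a.2.1 * x a.2.2| ≤ (b ^ 2 * p) * k := by
    rw [Fintype.sum_prod_type]
    have h4 : ∑ ij : Fin N × Fin N, |if ij.1 = ij.2 then 0 else x ij.1 * x ij.2| ≤ k := by
      refine le_trans ?_ hx1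
      rw [sq, Finset.sum_mul_sum, Fintype.sum_prod_type]
      refine Finset.sum_le_sum fun i _ => Finset.sum_le_sum fun j _ => ?_
      split_ifs
      · rw [abs_zero]; positivity
      · rw [abs_mul]
    calc _ ≤ ∑ _q : Fin (b ^ 2 * p), (k : ℝ) := Finset.sum_le_sum fun q _ => h4
      _ = _ := by simp
  have h5 : (((k : ℝ) * b) ^ p)⁻¹ * (∑ a : Fin (b ^ 2 * p) × Fin N × Fin N,
      |if a.2.1 = a.2.2 then 0 else x a.2.1 * x a.2.2|) ^ p ≤ (p * b * Real.exp 8) ^ p := by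
    calc _ ≤ (((k : ℝ) * b) ^ p)⁻¹ * ((b ^ 2 * p) * k) ^ p := by gcongr
      _ = (p * b * 1) ^ p := by
          rw [← inv_pow, ← mul_pow]
          congr 1
          field_simp
      _ ≤ _ := by
          gcongr
          exact Real.one_le_exp (by norm_num)
  linarith

theorem uniformProb_le_of_expect_pow_le {Ω : Type*} [Fintype Ω] (W : Ω → ℝ) {p : ℕ}
    (hp : Even p) {T B : ℝ} (hT : 0 < T)
    (hW : Finset.expect Finset.univ (fun ω => W ω ^ p) ≤ B) :
    uniformProb {ω | T ≤ |W ω|} ≤ B / T ^ p := by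
  classical
  rw [le_div_iff₀ (by positivity)]
  refine le_trans ?_ hW
  rw [uniformProb, Fintype.expect_eq_sum_div_card, div_mul_eq_mul_div]
  gcongr
  rw [Set.ncard_eq_toFinset_card', ← nsmul_eq_mul]
  calc _ ≤ ∑ ω ∈ {ω | T ≤ |W ω|}.toFinset, W ω ^ p := by
        refine Finset.card_nsmul_le_sum _ _ _ fun ω hω => ?_
        rw [Set.mem_toFinset] at hω
        rw [← hp.pow_abs (W ω)]
        exact pow_le_pow_left₀ hT.le hω p
    _ ≤ _ := Finset.sum_le_univ_sum_of_nonneg fun ω => hp.pow_nonneg _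

/-! ### A net of integer vectors and the restricted isometry property -/

/-- The integer vectors with at most `k` nonzero coordinates and `ℓ¹`-norm at most `k * D`. Scaled
by `1 / (√k * D)`, they are a `1 / D`-net of the `k`-sparse vectors in the unit ball. -/
noncomputable def sparseIntNet (N k D : ℕ) : Finset (Fin N → ℤ) :=
  (Fintype.piFinset fun _ => Finset.Icc (-((k * D : ℕ) : ℤ)) ((k * D : ℕ) : ℤ)).filter
    fun z => (Finset.univ.filter fun i => z i ≠ 0).card ≤ k ∧ ∑ i, (z i).natAbs ≤ k * D

theorem mem_sparseIntNet {N k D : ℕ} {z : Fin N → ℤ} : z ∈ sparseIntNet N k D ↔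
    (Finset.univ.filter fun i => z i ≠ 0).card ≤ k ∧ ∑ i, (z i).natAbs ≤ k * D := by
  rw [sparseIntNet, Finset.mem_filter, and_iff_right_iff_imp]
  rintro ⟨-, h⟩
  rw [Fintype.mem_piFinset]
  intro i
  have h1 : (z i).natAbs ≤ k * D :=
    (Finset.single_le_sum (f := fun i => (z i).natAbs) (fun _ _ => Nat.zero_le _)
      (Finset.mem_univ i)).trans h
  rw [Finset.mem_Icc]
  omega

/-- The weight of one coordinate in the count of the net. -/
theorem sum_Icc_geometric (c : ℝ) (M : ℕ) :
    ∑ n ∈ Finset.Icc (-(M : ℤ)) M, (if n = 0 then 1 else c * (1 / 2) ^ n.natAbs) =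
      1 + 2 * c * (1 - (1 / 2) ^ M) := by
  induction M with
  | zero => simp
  | succ M ih =>
    have h : Finset.Icc (-((M + 1 : ℕ) : ℤ)) ((M + 1 : ℕ) : ℤ) =
        insert (-((M + 1 : ℕ) : ℤ)) (insert ((M + 1 : ℕ) : ℤ) (Finset.Icc (-(M : ℤ)) M)) := by
      ext n
      simp only [Finset.mem_Icc, Finset.mem_insert]
      omega
    rw [h, Finset.sum_insert, Finset.sum_insert, ih, if_neg (by omega), if_neg (by omega),
      Int.natAbs_neg, Int.natAbs_natCast]
    · ring
    · simp
    · simp only [Finset.mem_Icc, Finset.mem_insert]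
      omega

/-- The count of the net weights each vector by a product over its coordinates, so that the number
of supports need not be estimated separately. -/
theorem card_sparseIntNet_le {N k D : ℕ} (hk : 1 ≤ k) (hkN : k ≤ N) :
    ((sparseIntNet N k D).card : ℝ) ≤
      Real.exp (k * Real.log (N / k) + k * D + 2 * k) := by
  have hk0 : (0 : ℝ) < k := by exact_mod_cast hk
  have hN0 : (0 : ℝ) < N := hk0.trans_le (by exact_mod_cast hkN)
  set c : ℝ := k / N with hc
  have hc0 : 0 < c := by positivity
  have hc1 : c ≤ 1 := by rw [hc, div_le_one hN0]; exact_mod_cast hkN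
  set w : ℤ → ℝ := fun n => if n = 0 then 1 else c * (1 / 2) ^ n.natAbs with hw
  have hw0 : ∀ n, 0 ≤ w n := by
    intro n
    simp only [hw]
    split_ifs <;> positivity
  have hlow : ∀ z ∈ sparseIntNet N k D, c ^ k * (1 / 2) ^ (k * D) ≤ ∏ i, w (z i) := by
    intro z hz
    obtain ⟨h1, h2⟩ := mem_sparseIntNet.mp hz
    have hprod : ∏ i, w (z i) =
        c ^ (Finset.univ.filter fun i => z i ≠ 0).card * (1 / 2) ^ (∑ i, (z i).natAbs) := by
      rw [← Finset.prod_pow_eq_pow_sum, ← Finset.prod_const, Finset.prod_filter,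
        ← Finset.prod_mul_distrib]
      refine Finset.prod_congr rfl fun i _ => ?_
      by_cases h : z i = 0 <;> simp [hw, h]
    rw [hprod]
    exact mul_le_mul (pow_le_pow_of_le_one hc0.le hc1 h1)
      (pow_le_pow_of_le_one (by norm_num) (by norm_num) h2) (by positivity) (by positivity)
  have hsum : ∑ z ∈ sparseIntNet N k D, ∏ i, w (z i) ≤ Real.exp (2 * k) := by
    calc _ ≤ ∑ z ∈ Fintype.piFinset
            fun _ : Fin N => Finset.Icc (-((k * D : ℕ) : ℤ)) ((k * D : ℕ) : ℤ),
            ∏ i, w (z i) :=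
          Finset.sum_le_sum_of_subset_of_nonneg (Finset.filter_subset _ _)
            fun z _ _ => Finset.prod_nonneg fun i _ => hw0 _
      _ = (1 + 2 * c * (1 - (1 / 2) ^ (k * D))) ^ N := by
          rw [← Finset.prod_univ_sum]
          simp only [hw]
          rw [Finset.prod_const, sum_Icc_geometric]
          simp
      _ ≤ (Real.exp (2 * c)) ^ N := by
          have h1 : (1 / 2 : ℝ) ^ (k * D) ≤ 1 := pow_le_one₀ (by norm_num) (by norm_num)
          have h2 : (0 : ℝ) ≤ (1 / 2) ^ (k * D) := by positivity
          have h3 := Real.add_one_le_exp (2 * c)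
          refine pow_le_pow_left₀ ?_ ?_ N
          · have := mul_nonneg hc0.le (sub_nonneg.mpr h1)
            linarith
          · have := mul_nonneg hc0.le h2
            linarith
      _ = Real.exp (2 * k) := by
          rw [← Real.exp_nat_mul]
          congr 1
          rw [hc]
          field_simp
  have h1 := (Finset.card_nsmul_le_sum _ _ _ hlow).trans hsum
  rw [nsmul_eq_mul] at h1
  have h2 : Real.exp (-(k * D)) * Real.exp (-(k * Real.log (N / k))) ≤
      c ^ k * (1 / 2) ^ (k * D) := by
    have e1 : Real.exp (-(k * Real.log (N / k))) = c ^ k := by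
      rw [← mul_neg, Real.exp_nat_mul, ← Real.log_inv, inv_div, Real.exp_log hc0]
    have e2 : Real.exp (-(k * D)) ≤ (1 / 2) ^ (k * D) := by
      rw [show -((k : ℝ) * D) = ((k * D : ℕ) : ℝ) * (-1) by push_cast; ring, Real.exp_nat_mul]
      gcongr
      rw [Real.exp_neg, one_div]
      gcongr
      have := Real.add_one_le_exp 1
      linarith
    rw [e1, mul_comm]
    gcongr
  have h3 := (mul_le_mul_of_nonneg_left h2 (Nat.cast_nonneg _)).trans h1
  rw [← Real.exp_add, ← le_div_iff₀ (Real.exp_pos _), ← Real.exp_sub] at h3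
  refine h3.trans_eq ?_
  congr 1
  ring

/-- Rounding towards zero. -/
noncomputable def roundToZero (t : ℝ) : ℤ := if 0 ≤ t then ⌊t⌋ else ⌈t⌉

theorem abs_sub_roundToZero_le (t : ℝ) : |t - roundToZero t| ≤ 1 := by
  rw [roundToZero, abs_le]
  split_ifs
  · have := Int.floor_le t; have := Int.lt_floor_add_one t
    constructor <;> linarith
  · have := Int.le_ceil t; have := Int.ceil_lt_add_one t
    constructor <;> linarith

theorem abs_roundToZero_le (t : ℝ) : |(roundToZero t : ℝ)| ≤ |t| := by
  rw [roundToZero]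
  split_ifs with h
  · have := Int.floor_le t
    have h0 : (0 : ℝ) ≤ ⌊t⌋ := by exact_mod_cast Int.floor_nonneg.mpr h
    rwa [abs_of_nonneg h, abs_of_nonneg h0]
  · have := Int.le_ceil t
    have h0 : (⌈t⌉ : ℝ) ≤ 0 := by exact_mod_cast Int.ceil_le.mpr (by push_cast; linarith)
    rw [abs_of_nonpos (not_le.mp h).le, abs_of_nonpos h0]
    linarith

theorem roundToZero_zero : roundToZero 0 = 0 := by simp [roundToZero]

/-- An integer vector as a vector of Euclidean space. -/
noncomputable def intVector {N : ℕ} (z : Fin N → ℤ) : EuclideanSpace ℝ (Fin N) :=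
  WithLp.toLp 2 fun i => (z i : ℝ)

theorem sq_sum_abs_le_of_sparse {N k : ℕ} (x : Fin N → ℝ)
    (hx : (Finset.univ.filter fun i => x i ≠ 0).card ≤ k) :
    (∑ i, |x i|) ^ 2 ≤ k * ∑ i, x i ^ 2 := by
  have h1 : ∑ i, |x i| = ∑ i ∈ Finset.univ.filter fun i => x i ≠ 0, |x i| := by
    rw [Finset.sum_filter]
    refine Finset.sum_congr rfl fun i _ => ?_
    by_cases h : x i = 0 <;> simp [h]
  have h2 : ∑ i ∈ Finset.univ.filter (fun i => x i ≠ 0), |x i| ^ 2 ≤ ∑ i, x i ^ 2 := by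
    simp_rw [sq_abs]
    exact Finset.sum_le_univ_sum_of_nonneg fun i => sq_nonneg _
  rw [h1]
  refine sq_sum_le_card_mul_sum_sq.trans ?_
  have h3 : ((Finset.univ.filter fun i => x i ≠ 0).card : ℝ) ≤ k := by exact_mod_cast hx
  exact mul_le_mul h3 h2 (Finset.sum_nonneg fun i _ => by positivity) (by positivity)

theorem isSparse_iff_card {N k : ℕ} (x : EuclideanSpace ℝ (Fin N)) :
    IsSparse k x ↔ (Finset.univ.filter fun i => x i ≠ 0).card ≤ k := by
  rw [IsSparse, Set.ncard_eq_toFinset_card', Set.toFinset_ofPred]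

/-- The net vector is found by rounding the coordinates of `√k D u` towards zero, which enlarges
neither the support nor the `ℓ¹`-norm. -/
theorem exists_net_vector {N k D : ℕ} (hk : 1 ≤ k) (hD : 1 ≤ D) (u : EuclideanSpace ℝ (Fin N))
    (hu : IsSparse k u) (hu1 : ‖u‖ = 1) :
    ∃ z ∈ sparseIntNet N k D, ∃ r : ℝ, IsSparse k (u - r • intVector z) ∧
      ‖u - r • intVector z‖ ≤ 1 / D := by
  have hk0 : (0 : ℝ) < k := by exact_mod_cast hk
  have hD0 : (0 : ℝ) < D := by exact_mod_cast hD
  set r : ℝ := √k * D with hr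
  have hr0 : 0 < r := by positivity
  have hr2 : r ^ 2 = k * D ^ 2 := by rw [hr, mul_pow, Real.sq_sqrt hk0.le]
  have hu' := (isSparse_iff_card u).mp hu
  have hnorm : ∑ i, u i ^ 2 = 1 := by
    rw [← EuclideanSpace.real_norm_sq_eq, hu1, one_pow]
  set z : Fin N → ℤ := fun i => roundToZero (u i * r) with hz
  have hz0 : ∀ i, u i = 0 → z i = 0 := fun i hi => by simp [hz, hi, roundToZero_zero]
  have happ : ∀ i, (u - r⁻¹ • intVector z) i = u i - r⁻¹ * z i := fun i => by
    simp [intVector]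
  have hd0 : ∀ i, u i = 0 → (u - r⁻¹ • intVector z) i = 0 := fun i hi => by
    rw [happ, hi, hz0 i hi]; simp
  refine ⟨z, mem_sparseIntNet.mpr ⟨?_, ?_⟩, r⁻¹, ?_, ?_⟩
  · refine (Finset.card_le_card fun i hi => ?_).trans hu'
    simp only [Finset.mem_filter, Finset.mem_univ, true_and] at hi ⊢
    exact fun h => hi (hz0 i h)
  · have h1 := sq_sum_abs_le_of_sparse u hu'
    rw [hnorm, mul_one] at h1
    have h2 : ∑ i, |u i| ≤ √k := Real.le_sqrt_of_sq_le h1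
    have h3 : ((∑ i, (z i).natAbs : ℕ) : ℝ) ≤ (k * D : ℕ) := by
      push_cast
      calc _ ≤ ∑ i, |u i| * r := by
            refine Finset.sum_le_sum fun i _ => ?_
            rw [Nat.cast_natAbs, Int.cast_abs]
            refine (abs_roundToZero_le _).trans_eq ?_
            rw [abs_mul, abs_of_pos hr0]
        _ = (∑ i, |u i|) * r := (Finset.sum_mul _ _ _).symm
        _ ≤ √k * r := by gcongr
        _ = _ := by rw [hr, ← mul_assoc, Real.mul_self_sqrt hk0.le]
    exact_mod_cast h3
  · rw [isSparse_iff_card]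
    refine (Finset.card_le_card fun i hi => ?_).trans hu'
    simp only [Finset.mem_filter, Finset.mem_univ, true_and] at hi ⊢
    exact fun h => hi (hd0 i h)
  · have h1 : ‖u - r⁻¹ • intVector z‖ ^ 2 ≤ (1 / D) ^ 2 := by
      rw [EuclideanSpace.real_norm_sq_eq]
      calc _ = ∑ i ∈ Finset.univ.filter fun i => u i ≠ 0, (u - r⁻¹ • intVector z) i ^ 2 := by
            rw [Finset.sum_filter]
            refine Finset.sum_congr rfl fun i _ => ?_
            by_cases h : u i = 0
            · rw [hd0 i h]; simp [h]
            · simp [h]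
        _ ≤ ∑ i ∈ Finset.univ.filter fun i => u i ≠ 0, (r⁻¹) ^ 2 := by
            refine Finset.sum_le_sum fun i _ => ?_
            have h2 : (u - r⁻¹ • intVector z) i = r⁻¹ * (u i * r - z i) := by
              rw [happ]; field_simp
            rw [h2, mul_pow]
            have h3 : (u i * r - z i) ^ 2 ≤ 1 := by
              rw [← sq_abs]
              exact pow_le_one₀ (abs_nonneg _) (abs_sub_roundToZero_le _)
            have h4 : (0 : ℝ) ≤ r⁻¹ ^ 2 := by positivity
            nlinarith
        _ ≤ k * (r⁻¹) ^ 2 := by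
            rw [Finset.sum_const, nsmul_eq_mul]
            have h3 : ((Finset.univ.filter fun i => u i ≠ 0).card : ℝ) ≤ k := by
              exact_mod_cast hu'
            gcongr
        _ = _ := by rw [inv_pow, hr2]; field_simp
    exact (abs_le_of_sq_le_sq' h1 (by positivity)).2

/-- If `Φ` nearly preserves the norms of the integer vectors in the net then it has the restricted
isometry property: the largest norm `a` of an image of a sparse unit vector satisfies
`a ≤ (1 + δ)² + a δ` with `δ = 1 / D`. -/
theorem hasRIP_of_net {Q N k D : ℕ} {η : ℝ} (hk : 1 ≤ k) (hD : 16 ≤ D) (hη : 16 / D ≤ η)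
    (Φ : Matrix (Fin Q) (Fin N) ℝ)
    (hnet : ∀ z ∈ sparseIntNet N k D, z ≠ 0 →
      |‖Matrix.toEuclideanLin Φ (intVector z)‖ ^ 2 - ‖intVector z‖ ^ 2| ≤
        1 / D * ‖intVector z‖ ^ 2) :
    HasRIP k η Φ := by
  have hD16 : (16 : ℝ) ≤ D := by exact_mod_cast hD
  set L := Matrix.toEuclideanLin Φ with hL
  obtain ⟨δ, hδ⟩ : ∃ δ : ℝ, δ = 1 / D := ⟨_, rfl⟩
  have hδ0 : 0 < δ := by rw [hδ]; positivity
  have hδ1 : δ ≤ 1 / 16 := by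
    rw [hδ]
    gcongr
  have hη' : 16 * δ ≤ η := by rw [hδ]; convert hη using 1; ring
  -- multiples of net vectors
  have hv : ∀ z ∈ sparseIntNet N k D, ∀ r : ℝ,
      ‖L (r • intVector z)‖ ≤ (1 + δ) * ‖r • intVector z‖ ∧
      (1 - δ) * ‖r • intVector z‖ ≤ ‖L (r • intVector z)‖ := by
    intro z hz r
    have h1 : |‖L (intVector z)‖ ^ 2 - ‖intVector z‖ ^ 2| ≤ δ * ‖intVector z‖ ^ 2 := by
      by_cases h0 : z = 0
      · have h2 : intVector z = 0 := by ext i; simp [intVector, h0]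
        rw [h2, map_zero, norm_zero]
        simp
      · rw [hδ]; exact hnet z hz h0
    obtain ⟨h2, h3⟩ := abs_le.mp h1
    have hn := norm_nonneg (intVector z)
    have hsq := mul_nonneg hδ0.le (sq_nonneg ‖intVector z‖)
    have h4 : ‖L (intVector z)‖ ≤ (1 + δ) * ‖intVector z‖ := by
      refine (abs_le_of_sq_le_sq' ?_ (by positivity)).2
      nlinarith
    have h5 : (1 - δ) * ‖intVector z‖ ≤ ‖L (intVector z)‖ := by
      refine (abs_le_of_sq_le_sq' ?_ (norm_nonneg _)).2
      nlinarith
    rw [map_smul, norm_smul, norm_smul]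
    have hr := norm_nonneg r
    constructor
    · rw [mul_left_comm]; gcongr
    · rw [mul_left_comm]; gcongr
  set A : Set ℝ := {y | ∃ u, IsSparse k u ∧ ‖u‖ = 1 ∧ y = ‖L u‖} with hA
  have hbdd : BddAbove A := by
    refine ⟨‖LinearMap.toContinuousLinearMap L‖, ?_⟩
    rintro y ⟨u, -, hu1, rfl⟩
    have := (LinearMap.toContinuousLinearMap L).le_opNorm u
    rwa [hu1, mul_one] at this
  obtain ⟨a, ha⟩ : ∃ a, a = sSup A := ⟨_, rfl⟩
  have ha0 : 0 ≤ a := by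
    rw [ha]
    refine Real.sSup_nonneg ?_
    rintro y ⟨u, -, -, rfl⟩
    exact norm_nonneg _
  have hle : ∀ u, IsSparse k u → ‖L u‖ ≤ a * ‖u‖ := by
    intro u hu
    by_cases h0 : u = 0
    · simp [h0]
    have hpos : 0 < ‖u‖ := norm_pos_iff.mpr h0
    have h1 : ‖L (‖u‖⁻¹ • u)‖ ≤ a := by
      rw [ha]
      refine le_csSup hbdd ⟨_, ?_, ?_, rfl⟩
      · rw [isSparse_iff_card] at hu ⊢
        simpa [h0] using hu
      · rw [norm_smul, norm_inv, norm_norm, inv_mul_cancel₀ hpos.ne']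
    rw [map_smul, norm_smul, norm_inv, norm_norm, inv_mul_le_iff₀ hpos] at h1
    linarith
  have happrox : ∀ u, IsSparse k u → ‖u‖ = 1 → ∃ v : EuclideanSpace ℝ (Fin N),
      ‖L v‖ ≤ (1 + δ) ^ 2 ∧ (1 - δ) ^ 2 ≤ ‖L v‖ ∧ ‖L u - L v‖ ≤ a * δ := by
    intro u hu hu1
    obtain ⟨z, hz, r, h1, h2⟩ := exists_net_vector hk (by omega : 1 ≤ D) u hu hu1
    rw [← hδ] at h2
    obtain ⟨h3, h4⟩ := hv z hz r
    have h5 : |‖u‖ - ‖r • intVector z‖| ≤ δ := (abs_norm_sub_norm_le _ _).trans h2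
    rw [hu1] at h5
    obtain ⟨h6, h7⟩ := abs_le.mp h5
    refine ⟨r • intVector z, ?_, ?_, ?_⟩
    · nlinarith
    · nlinarith
    · rw [← map_sub]
      exact (hle _ h1).trans (by gcongr)
  have ha1 : a ≤ (1 + δ) ^ 2 + a * δ := by
    conv_lhs => rw [ha]
    refine Real.sSup_le ?_ (by positivity)
    rintro y ⟨u, hu, hu1, rfl⟩
    obtain ⟨v, h1, -, h3⟩ := happrox u hu hu1
    have := norm_sub_norm_le (L u) (L v)
    linarith
  have ha2 : a ≤ 1 + 4 * δ := by nlinarith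
  intro x hx
  by_cases h0 : x = 0
  · simp [h0]
  have hpos : 0 < ‖x‖ := norm_pos_iff.mpr h0
  have hup : ‖L x‖ ≤ (1 + 4 * δ) * ‖x‖ :=
    (hle x hx).trans (by gcongr)
  have hlow : (1 - 4 * δ) * ‖x‖ ≤ ‖L x‖ := by
    obtain ⟨v, -, h2, h3⟩ := happrox (‖x‖⁻¹ • x)
      (by rw [isSparse_iff_card] at hx ⊢; simpa [h0] using hx)
      (by rw [norm_smul, norm_inv, norm_norm, inv_mul_cancel₀ hpos.ne'])
    have h4 := norm_sub_norm_le (L v) (L (‖x‖⁻¹ • x))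
    rw [norm_sub_rev] at h4
    have h5 : 1 - 4 * δ ≤ ‖L (‖x‖⁻¹ • x)‖ := by nlinarith
    rw [map_smul, norm_smul, norm_inv, norm_norm, inv_mul_eq_div, le_div_iff₀ hpos] at h5
    exact h5
  have hx2 := sq_nonneg ‖x‖
  constructor
  · have h1 : ((1 - 4 * δ) * ‖x‖) ^ 2 ≤ ‖L x‖ ^ 2 := by
      refine pow_le_pow_left₀ (mul_nonneg (by linarith) hpos.le) hlow 2
    rw [mul_pow] at h1
    refine le_trans ?_ h1
    gcongr
    nlinarith
  · have h1 : ‖L x‖ ^ 2 ≤ ((1 + 4 * δ) * ‖x‖) ^ 2 :=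
      pow_le_pow_left₀ (norm_nonneg _) hup 2
    rw [mul_pow] at h1
    refine h1.trans ?_
    gcongr
    nlinarith

/-! ### The restricted isometry property of random sign matrices -/

theorem norm_scaledMatrix_sq {Q N : ℕ} (s : Fin Q × Fin N → ℤ) (x : EuclideanSpace ℝ (Fin N)) :
    ‖Matrix.toEuclideanLin (scaledMatrix s) x‖ ^ 2 =
      (∑ q, (∑ j, (s (q, j) : ℝ) * x j) ^ 2) / Q := by
  rw [EuclideanSpace.real_norm_sq_eq, Finset.sum_div]
  refine Finset.sum_congr rfl fun q _ => ?_
  have h : (Matrix.toEuclideanLin (scaledMatrix s) x) q =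
      (∑ j, (s (q, j) : ℝ) * x j) / √Q := by
    simp only [Matrix.toLpLin_apply, Matrix.mulVec, dotProduct, scaledMatrix, Finset.sum_div]
    exact Finset.sum_congr rfl fun j _ => by ring
  rw [h, div_pow, Real.sq_sqrt (Nat.cast_nonneg _)]

theorem norm_sq_scaledMatrix_sub {Q N : ℕ} (hQ : 0 < Q) (s : Fin Q × Fin N → ℤ)
    (x : EuclideanSpace ℝ (Fin N)) (hx : 0 < ‖x‖) :
    ‖Matrix.toEuclideanLin (scaledMatrix s) x‖ ^ 2 - ‖x‖ ^ 2 =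
      ‖x‖ ^ 2 * (isometryError (fun j => x j / ‖x‖) (fun i => (s i : ℝ)) / Q) := by
  have hQ' : (0 : ℝ) < Q := by exact_mod_cast hQ
  have h : isometryError (fun j => x j / ‖x‖) (fun i => (s i : ℝ)) =
      (∑ q, (∑ j, (s (q, j) : ℝ) * x j) ^ 2) / ‖x‖ ^ 2 - Q := by
    rw [isometryError, Finset.sum_sub_distrib, Finset.sum_div]
    congr 1
    · refine Finset.sum_congr rfl fun q _ => ?_
      rw [← div_pow, Finset.sum_div]
      simp_rw [mul_div_assoc]
    · simp
  rw [norm_scaledMatrix_sq, h]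
  field_simp

theorem uniformProb_compl {Ω : Type*} [Fintype Ω] [Nonempty Ω] (E : Set Ω) :
    uniformProb Eᶜ = 1 - uniformProb E := by
  have h := Set.ncard_add_ncard_compl E
  rw [Nat.card_eq_fintype_card] at h
  have hpos : (0 : ℝ) < Fintype.card Ω := by exact_mod_cast Fintype.card_pos
  rw [uniformProb, uniformProb, eq_sub_iff_add_eq, ← add_div, div_eq_one_iff_eq hpos.ne']
  exact_mod_cast (add_comm _ _).trans h

theorem uniformProb_mono {Ω : Type*} [Fintype Ω] {E F : Set Ω} (h : E ⊆ F) :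
    uniformProb E ≤ uniformProb F := by
  unfold uniformProb
  gcongr
  exact Set.toFinite _

theorem uniformProb_biUnion_le {Ω α : Type*} [Fintype Ω] (t : Finset α) (E : α → Set Ω) {B : ℝ}
    (hB : ∀ a ∈ t, uniformProb (E a) ≤ B) :
    uniformProb (⋃ a ∈ t, E a) ≤ t.card * B := by
  have h1 : uniformProb (⋃ a ∈ t, E a) ≤ ∑ a ∈ t, uniformProb (E a) := by
    unfold uniformProb
    rw [← Finset.sum_div]
    gcongr
    exact_mod_cast Finset.set_ncard_biUnion_le t E
  refine h1.trans ?_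
  rw [← nsmul_eq_mul]
  exact Finset.sum_le_card_nsmul _ _ _ hB

/-- A random sign matrix with `b² p` rows whose signs have bias at most `(k b)^(-p)` has the
restricted isometry property with high probability: Markov's inequality for the `p`-th moment and
a union bound over the net. -/
theorem uniformProb_hasRIP_ge {Ω : Type*} [Fintype Ω] [Nonempty Ω] {Q N k b p D : ℕ} {η A : ℝ}
    (hQp : Q = b ^ 2 * p)
    (hk : 1 ≤ k) (hkN : k ≤ N) (hb : 8 ≤ b) (hp : Even p) (hp0 : 0 < p)
    (hD : 16 ≤ D) (hη : 16 / D ≤ η) (hbD : Real.exp 9 * D ≤ b)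
    (hpk : (1 + A) * (k * Real.log (N / k)) + k * D + 2 * k + 2 ≤ p)
    (S : Ω → Fin Q × Fin N → ℤ) (hS : ∀ ω i, S ω i = 1 ∨ S ω i = -1)
    (hbias : ∀ y : Finset (Fin Q × Fin N), y.Nonempty →
      |Finset.expect Finset.univ (fun ω => ∏ i ∈ y, (S ω i : ℝ))| ≤ (((k : ℝ) * b) ^ p)⁻¹) :
    1 - Real.exp (-(A * (k * Real.log (N / k)))) ≤
      uniformProb {ω | HasRIP k η (scaledMatrix (S ω))} := by
  classical
  subst hQp
  have hb0 : (0 : ℝ) < b := by positivity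
  have hD0 : (0 : ℝ) < D := by positivity
  have hp0' : (0 : ℝ) < p := by exact_mod_cast hp0
  have hQ : 0 < b ^ 2 * p := by positivity
  set T : ℝ := (b ^ 2 * p : ℕ) / D with hT
  have hT0 : 0 < T := by rw [hT]; positivity
  let W : (Fin N → ℤ) → Ω → ℝ := fun z ω =>
    isometryError (fun j => intVector z j / ‖intVector z‖) (fun i => (S ω i : ℝ))
  set net := (sparseIntNet N k D).filter (fun z => z ≠ 0) with hnet
  have hone : ∀ z ∈ net, uniformProb {ω | T ≤ |W z ω|} ≤ Real.exp (2 - p) := by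
    intro z hz
    obtain ⟨hz1, hz0⟩ := Finset.mem_filter.mp hz
    obtain ⟨hz2, -⟩ := mem_sparseIntNet.mp hz1
    have hv0 : intVector z ≠ 0 := by
      intro h
      refine hz0 (funext fun i => ?_)
      have := congrArg (fun v : EuclideanSpace ℝ (Fin N) => v i) h
      simpa [intVector] using this
    have hn : 0 < ‖intVector z‖ := norm_pos_iff.mpr hv0
    have hx : ∑ j, (intVector z j / ‖intVector z‖) ^ 2 = 1 := by
      simp_rw [div_pow]
      rw [← Finset.sum_div, ← EuclideanSpace.real_norm_sq_eq, div_self (by positivity)]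
    have hx1 : (∑ j, |intVector z j / ‖intVector z‖|) ^ 2 ≤ k := by
      have := sq_sum_abs_le_of_sparse (k := k) (fun j => intVector z j / ‖intVector z‖) (by
        refine (Finset.card_le_card fun i hi => ?_).trans hz2
        simp only [Finset.mem_filter, Finset.mem_univ, true_and] at hi ⊢
        exact fun h => hi (by simp [intVector, h]))
      rwa [hx, mul_one] at this
    have hm := expect_biased_isometryError_pow_le hk hb hp S hS hbias _ hx hx1
    refine (uniformProb_le_of_expect_pow_le (W z) hp hT0 hm).trans ?_
    rw [mul_div_assoc, ← div_pow]
    have h1 : p * b * Real.exp 8 / T ≤ Real.exp (-1) := by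
      have h2 : p * b * Real.exp 8 / T = Real.exp 8 * D / b := by
        rw [hT]
        push_cast
        field_simp
      rw [h2, div_le_iff₀ hb0]
      calc Real.exp 8 * D = Real.exp (-1) * (Real.exp 9 * D) := by
            rw [← mul_assoc, ← Real.exp_add]; norm_num
        _ ≤ _ := by gcongr
    have h3 : (3 : ℝ) ≤ Real.exp 2 := by
      have := Real.add_one_le_exp (2 : ℝ); linarith
    calc _ ≤ Real.exp 2 * Real.exp (-1) ^ p := by gcongr
      _ = _ := by rw [← Real.exp_nat_mul, ← Real.exp_add]; congr 1; ring
  have hbad : {ω | HasRIP k η (scaledMatrix (S ω))}ᶜ ⊆ ⋃ z ∈ net, {ω | T ≤ |W z ω|} := by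
    intro ω hω
    by_contra hcon
    simp only [Set.mem_iUnion, Set.mem_ofPred_eq, not_exists, not_le] at hcon
    refine hω (hasRIP_of_net hk hD hη _ fun z hz hz0 => ?_)
    have hv0 : intVector z ≠ 0 := by
      intro h
      refine hz0 (funext fun i => ?_)
      have := congrArg (fun v : EuclideanSpace ℝ (Fin N) => v i) h
      simpa [intVector] using this
    have hlt := hcon z (Finset.mem_filter.mpr ⟨hz, hz0⟩)
    have hQ' : (0 : ℝ) < (b ^ 2 * p : ℕ) := by exact_mod_cast hQ
    rw [norm_sq_scaledMatrix_sub hQ _ _ (norm_pos_iff.mpr hv0), abs_mul, abs_sq, mul_comm, abs_div,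
      abs_of_pos hQ']
    refine mul_le_mul_of_nonneg_right ?_ (sq_nonneg _)
    rw [div_le_iff₀ hQ']
    refine hlt.le.trans_eq ?_
    rw [hT]
    ring
  have hcard : (net.card : ℝ) ≤ Real.exp (k * Real.log (N / k) + k * D + 2 * k) :=
    le_trans (by exact_mod_cast Finset.card_filter_le _ _) (card_sparseIntNet_le hk hkN)
  have hprob : uniformProb {ω | HasRIP k η (scaledMatrix (S ω))}ᶜ ≤
      Real.exp (-(A * (k * Real.log (N / k)))) := by
    calc _ ≤ net.card * Real.exp (2 - p) :=
          (uniformProb_mono hbad).trans (uniformProb_biUnion_le net _ hone)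
      _ ≤ Real.exp (k * Real.log (N / k) + k * D + 2 * k) * Real.exp (2 - p) := by gcongr
      _ ≤ _ := by
          rw [← Real.exp_add]
          gcongr
          linarith
  rw [uniformProb_compl] at hprob
  linarith

theorem hasRIP_one {Q N : ℕ} (hQ : 0 < Q) {η : ℝ} (hη : 0 ≤ η) (s : Fin Q × Fin N → ℤ)
    (hs : ∀ i, s i = 1 ∨ s i = -1) : HasRIP 1 η (scaledMatrix s) := by
  intro x hx
  have hQ' : (0 : ℝ) < Q := by exact_mod_cast hQ
  have hoff : ∀ i j, i ≠ j → x i * x j = 0 := by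
    intro i j hij
    by_contra h
    obtain ⟨hi, hj⟩ := mul_ne_zero_iff.mp h
    have h1 := Finset.card_le_one.mp ((isSparse_iff_card x).mp hx) i (by simpa using hi) j
      (by simpa using hj)
    exact hij h1
  have hrow : ∀ q, (∑ j, (s (q, j) : ℝ) * x j) ^ 2 = ‖x‖ ^ 2 := by
    intro q
    rw [EuclideanSpace.real_norm_sq_eq, sq, Finset.sum_mul_sum]
    refine Finset.sum_congr rfl fun i _ => ?_
    rw [Finset.sum_eq_single i]
    · have h1 : (s (q, i) : ℝ) * s (q, i) = 1 := by rcases hs (q, i) with h | h <;> simp [h]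
      linear_combination x i ^ 2 * h1
    · intro j _ hji
      have := hoff i j hji.symm
      linear_combination (s (q, i) : ℝ) * s (q, j) * this
    · simp
  have hnorm : ‖Matrix.toEuclideanLin (scaledMatrix s) x‖ ^ 2 = ‖x‖ ^ 2 := by
    rw [norm_scaledMatrix_sq]
    simp_rw [hrow]
    simp only [Finset.sum_const, Finset.card_univ, Fintype.card_fin, nsmul_eq_mul]
    field_simp
  rw [hnorm]
  have := mul_nonneg hη (sq_nonneg ‖x‖)
  constructor <;> linarith

/-! ### Reasoning about programs -/

namespace RandRAM

/-- Started in `s`, the program `p` halts after at most `B` steps in a state that satisfies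
`Post`. -/
def Runs (p : Prog) (s : State) (B : ℕ) (Post : State → Prop) : Prop :=
  ∃ t ≤ B, ∃ s', Exec p s t s' ∧ Post s'

section rules

variable {p q : Prog} {s : State} {B C a b c d : ℕ} {Mid Post : State → Prop}

theorem Runs.mono (h : Runs p s B Mid) (hBC : B ≤ C) (hPost : ∀ s', Mid s' → Post s') :
    Runs p s C Post := by
  obtain ⟨t, ht, s', he, hs⟩ := h
  exact ⟨t, ht.trans hBC, s', he, hPost s' hs⟩

theorem Runs.seq (hp : Runs p s B Mid) (hq : ∀ s', Mid s' → Runs q s' C Post) :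
    Runs (.seq p q) s (B + C) Post := by
  obtain ⟨t, ht, s', he, hs⟩ := hp
  obtain ⟨t', ht', s'', he', hs'⟩ := hq s' hs
  exact ⟨t + t', add_le_add ht ht', s'', .seq he he', hs'⟩

theorem Runs.const (h : Post (s.setReg d c)) : Runs (.const d c) s 1 Post :=
  ⟨1, le_rfl, _, .const s d c, h⟩

theorem Runs.add (h : Post (s.setReg d (s.reg a + s.reg b))) : Runs (.add d a b) s 1 Post :=
  ⟨1, le_rfl, _, .add s d a b, h⟩

theorem Runs.sub (h : Post (s.setReg d (s.reg a - s.reg b))) : Runs (.sub d a b) s 1 Post :=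
  ⟨1, le_rfl, _, .sub s d a b, h⟩

theorem Runs.store (h : Post (s.setMem (s.reg a) (s.reg b))) : Runs (.store a b) s 1 Post :=
  ⟨1, le_rfl, _, .store s a b, h⟩

theorem Runs.const_seq (h : Runs q (s.setReg d c) B Post) :
    Runs (.seq (.const d c) q) s (B + 1) Post := by
  rw [add_comm]
  exact Runs.seq (Mid := fun s' => s' = s.setReg d c) (.const rfl) fun s' hs => hs ▸ h

theorem Runs.add_seq (h : Runs q (s.setReg d (s.reg a + s.reg b)) B Post) :
    Runs (.seq (.add d a b) q) s (B + 1) Post := by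
  rw [add_comm]
  exact Runs.seq (Mid := fun s' => s' = s.setReg d (s.reg a + s.reg b)) (.add rfl)
    fun s' hs => hs ▸ h

theorem Runs.sub_seq (h : Runs q (s.setReg d (s.reg a - s.reg b)) B Post) :
    Runs (.seq (.sub d a b) q) s (B + 1) Post := by
  rw [add_comm]
  exact Runs.seq (Mid := fun s' => s' = s.setReg d (s.reg a - s.reg b)) (.sub rfl)
    fun s' hs => hs ▸ h

theorem Runs.load_seq (h : Runs q (s.setReg d (s.mem (s.reg a))) B Post) :
    Runs (.seq (.load d a) q) s (B + 1) Post := by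
  rw [add_comm]
  exact Runs.seq (Mid := fun s' => s' = s.setReg d (s.mem (s.reg a)))
    ⟨1, le_rfl, _, .load s d a, rfl⟩ fun s' hs => hs ▸ h

theorem Runs.store_seq (h : Runs q (s.setMem (s.reg a) (s.reg b)) B Post) :
    Runs (.seq (.store a b) q) s (B + 1) Post := by
  rw [add_comm]
  exact Runs.seq (Mid := fun s' => s' = s.setMem (s.reg a) (s.reg b)) (.store rfl)
    fun s' hs => hs ▸ h

theorem Runs.coin_seq {x : Bool} {l : List Bool} (hl : s.tape = x :: l)
    (h : Runs q (State.setReg { s with tape := l } d x.toNat) B Post) :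
    Runs (.seq (.coin d) q) s (B + 1) Post := by
  rw [add_comm]
  exact Runs.seq (Mid := fun s' => s' = State.setReg { s with tape := l } d x.toNat)
    ⟨1, le_rfl, _, .coin s d x l hl, rfl⟩ fun s' hs => hs ▸ h

theorem Runs.branch (hp : s.reg a ≠ 0 → Runs p s B Post) (hq : s.reg a = 0 → Runs q s B Post) :
    Runs (.branch a p q) s (B + 1) Post := by
  by_cases h : s.reg a = 0
  · obtain ⟨t, ht, s', he, hs⟩ := hq h
    exact ⟨t + 1, by omega, s', .branch_zero h he, hs⟩
  · obtain ⟨t, ht, s', he, hs⟩ := hp h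
    exact ⟨t + 1, by omega, s', .branch_pos h he, hs⟩

/-- A loop with the invariant `I i` after `i` of exactly `n` rounds. -/
theorem Runs.loop (n : ℕ) (I : ℕ → State → Prop) (h0 : I 0 s)
    (hstep : ∀ i < n, ∀ s, I i s → s.reg a ≠ 0 ∧ Runs p s B (I (i + 1)))
    (hend : ∀ s, I n s → s.reg a = 0) :
    Runs (.loop a p) s (n * (B + 1) + 1) (I n) := by
  have key : ∀ j i s, i + j = n → I i s → Runs (.loop a p) s (j * (B + 1) + 1) (I n) := by
    intro j
    induction j with
    | zero =>
      intro i s hij hI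
      obtain rfl : i = n := by omega
      exact ⟨1, by omega, s, .loop_zero (hend s hI), hI⟩
    | succ j ih =>
      intro i s hij hI
      obtain ⟨ha, t, ht, s', he, hs⟩ := hstep i (by omega) s hI
      obtain ⟨t', ht', s'', he', hs'⟩ := ih (i + 1) s' (by omega) hs
      refine ⟨t + t' + 1, ?_, s'', .loop_pos ha he he', hs'⟩
      rw [Nat.succ_mul]
      omega
  exact key n 0 s (by omega) h0

end rules

@[simp] theorem State.setReg_mem (s : State) (d v : ℕ) : (s.setReg d v).mem = s.mem := rfl
@[simp] theorem State.setReg_tape (s : State) (d v : ℕ) : (s.setReg d v).tape = s.tape := rfl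
@[simp] theorem State.setMem_reg (s : State) (a v : ℕ) : (s.setMem a v).reg = s.reg := rfl
@[simp] theorem State.setMem_tape (s : State) (a v : ℕ) : (s.setMem a v).tape = s.tape := rfl
@[simp] theorem State.setMem_mem (s : State) (a v : ℕ) :
    (s.setMem a v).mem = Function.update s.mem a v := rfl
theorem State.setReg_reg (s : State) (d v r : ℕ) :
    (s.setReg d v).reg r = if r = d then v else s.reg r := by
  simp [State.setReg, Function.update_apply]

/-! ### Arithmetic subroutines

Throughout, register `2` holds the constant `1` and register `3` the constant `0`. Subroutines that
call others use registers with smaller numbers, so that what a call leaves unchanged can be stated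
as a bound on the register number. -/

/-- `d := a * b`, by repeated addition; uses register `13`. -/
def mulProg (d a b : ℕ) : Prog :=
  .seq (.add 13 b 3) <| .seq (.const d 0) <|
    .loop 13 (.seq (.add d d a) (.sub 13 13 2))

theorem mulProg_runs (s : State) (d a b : ℕ) (ha : a ≠ d) (ha' : a < 13) (hd : d < 13)
    (h2 : s.reg 2 = 1) (h3 : s.reg 3 = 0) (hd2 : d ≠ 2) :
    Runs (mulProg d a b) s (3 * s.reg b + 3) (fun s' => s'.reg d = s.reg a * s.reg b ∧
      s'.mem = s.mem ∧ s'.tape = s.tape ∧ ∀ r < 13, r ≠ d → s'.reg r = s.reg r) := by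
  obtain ⟨n, hn⟩ : ∃ n, n = s.reg b := ⟨_, rfl⟩
  rw [← hn]
  have hB : 3 * n + 3 = (n * (2 + 1) + 1) + 1 + 1 := by ring
  rw [hB]
  refine Runs.add_seq (Runs.const_seq ?_)
  refine (Runs.loop n (fun i s' => s'.reg d = s.reg a * i ∧ s'.reg 13 = n - i ∧
      s'.mem = s.mem ∧ s'.tape = s.tape ∧ ∀ r < 13, r ≠ d → s'.reg r = s.reg r)
      ?_ ?_ ?_).mono le_rfl ?_
  · refine ⟨by simp [State.setReg_reg], ?_, rfl, rfl, ?_⟩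
    · simp [State.setReg_reg, h3, hn, show ¬ 13 = d by omega]
    · intro r hr hrd
      simp [State.setReg_reg, hrd, show ¬ r = 13 by omega]
  · rintro i hi t ⟨t1, t2, t3, t4, t5⟩
    refine ⟨by omega, ?_⟩
    refine Runs.add_seq (Runs.sub ⟨?_, ?_, t3, t4, ?_⟩)
    · simp [State.setReg_reg, t1, t5 a ha' ha, show ¬ d = 13 by omega]
      ring
    · simp [State.setReg_reg, t2, show ¬ 13 = d by omega, show ¬ 2 = d by omega,
        t5 2 (by omega) (by omega), h2]
      omega
    · intro r hr hrd
      simp [State.setReg_reg, hrd, show ¬ r = 13 by omega, t5 r hr hrd]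
  · rintro t ⟨t1, t2, -⟩
    omega
  · rintro t ⟨t1, t2, t3, t4, t5⟩
    exact ⟨t1, t3, t4, t5⟩

/-- The least `e` with `T ≤ a * 3 ^ e`, for positive `a`. -/
noncomputable def triplings (a T : ℕ) : ℕ := sInf {e | T ≤ a * 3 ^ e}

theorem le_mul_three_pow (a T : ℕ) (ha : 1 ≤ a) : T ≤ a * 3 ^ T :=
  (Nat.lt_pow_self (by norm_num : 1 < 3)).le.trans (Nat.le_mul_of_pos_left _ ha)

theorem triplings_spec (a T : ℕ) (ha : 1 ≤ a) : T ≤ a * 3 ^ triplings a T :=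
  Nat.sInf_mem (s := {e | T ≤ a * 3 ^ e}) ⟨T, le_mul_three_pow a T ha⟩

theorem triplings_le (a T : ℕ) (ha : 1 ≤ a) : triplings a T ≤ T :=
  Nat.sInf_le (le_mul_three_pow a T ha)

theorem lt_of_lt_triplings {a T e : ℕ} (he : e < triplings a T) : a * 3 ^ e < T :=
  not_le.mp (Nat.notMem_of_lt_sInf (s := {e | T ≤ a * 3 ^ e}) he)

/-- A loop for a logarithm: triples register `13` until it is at least register `a`, and counts the rounds in `d`. -/
def triplingProg (d a : ℕ) : Prog :=
  .seq (.const d 0) <| .seq (.sub 14 a 13) <|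
    .loop 14 (.seq (.add 15 13 13) <| .seq (.add 13 13 15) <| .seq (.add d d 2) (.sub 14 a 13))

theorem triplingProg_runs (s : State) (d a : ℕ) (ha : a ≠ d) (ha' : a < 13) (hd : d < 13)
    (hd2 : d ≠ 2) (h2 : s.reg 2 = 1) (h13 : 1 ≤ s.reg 13) :
    Runs (triplingProg d a) s (5 * s.reg a + 3) (fun s' =>
      s'.reg d = triplings (s.reg 13) (s.reg a) ∧
      s'.reg 13 = s.reg 13 * 3 ^ triplings (s.reg 13) (s.reg a) ∧
      s'.mem = s.mem ∧ s'.tape = s.tape ∧ ∀ r < 13, r ≠ d → s'.reg r = s.reg r) := by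
  obtain ⟨v, hv⟩ : ∃ v, v = s.reg 13 := ⟨_, rfl⟩
  obtain ⟨T, hT⟩ : ∃ T, T = s.reg a := ⟨_, rfl⟩
  rw [← hv, ← hT]
  rw [← hv] at h13
  have hspec := triplings_spec v T h13
  have hle := triplings_le v T h13
  have hlt := fun e => lt_of_lt_triplings (a := v) (T := T) (e := e)
  generalize triplings v T = n at *
  have hB : (n * (4 + 1) + 1) + 1 + 1 ≤ 5 * T + 3 := by omega
  refine Runs.mono (Mid := fun s' => s'.reg d = n ∧ s'.reg 13 = v * 3 ^ n ∧
      s'.mem = s.mem ∧ s'.tape = s.tape ∧ ∀ r < 13, r ≠ d → s'.reg r = s.reg r) ?_ hB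
      (fun _ h => h)
  refine Runs.const_seq (Runs.sub_seq ?_)
  refine (Runs.loop n (fun i s' => s'.reg 14 = T - v * 3 ^ i ∧ s'.reg d = i ∧
      s'.reg 13 = v * 3 ^ i ∧
      s'.mem = s.mem ∧ s'.tape = s.tape ∧ ∀ r < 13, r ≠ d → s'.reg r = s.reg r)
      ?_ ?_ ?_).mono le_rfl ?_
  · refine ⟨?_, ?_, ?_, rfl, rfl, ?_⟩
    · simp [State.setReg_reg, show ¬ 13 = d by omega, ha, hv, hT]
    · simp [State.setReg_reg, show ¬ d = 14 by omega]
    · simp [State.setReg_reg, show ¬ 13 = d by omega, hv]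
    · intro r hr hrd
      simp [State.setReg_reg, hrd, show ¬ r = 14 by omega]
  · rintro i hi t ⟨t1, t2, t3, t4, t5, t6⟩
    refine ⟨by have := hlt i hi; omega, ?_⟩
    refine Runs.add_seq (Runs.add_seq (Runs.add_seq (Runs.sub ⟨?_, ?_, ?_, t4, t5, ?_⟩)))
    · have e1 : v * 3 ^ (i + 1) = v * 3 ^ i + (v * 3 ^ i + v * 3 ^ i) := by ring
      simp [State.setReg_reg, show ¬ 13 = d by omega, ha, show ¬ a = 13 by omega,
        show ¬ a = 15 by omega, t6 a ha' ha, ← hT, t3, e1]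
    · simp [State.setReg_reg, show ¬ d = 14 by omega, show ¬ d = 13 by omega,
        show ¬ d = 15 by omega, t2, t6 2 (by omega) (by omega), h2]
    · have e1 : v * 3 ^ (i + 1) = v * 3 ^ i + (v * 3 ^ i + v * 3 ^ i) := by ring
      simp [State.setReg_reg, show ¬ 13 = d by omega, t3, e1]
    · intro r hr hrd
      simp [State.setReg_reg, hrd, show ¬ r = 13 by omega, show ¬ r = 14 by omega,
        show ¬ r = 15 by omega, t6 r hr hrd]
  · rintro t ⟨t1, -⟩
    omega
  · rintro t ⟨-, t2, t3, t4, t5, t6⟩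
    exact ⟨t2, t3, t4, t5, t6⟩

end RandRAM

/-! ### Multiplication of field elements stored in memory -/

namespace RandRAM

/-- The exclusive or of two bits, by truncated subtraction. -/
def xorNat (x y : ℕ) : ℕ := (x - y) + (y - x)

theorem xorNat_le_one {x y : ℕ} (hx : x ≤ 1) (hy : y ≤ 1) : xorNat x y ≤ 1 := by
  unfold xorNat; omega

theorem xorNat_cast {R : Type*} [Ring R] (h2 : (2 : R) = 0) {x y : ℕ} (hx : x ≤ 1) (hy : y ≤ 1) :
    (xorNat x y : R) = y + x := by
  have h : (1 : R) + 1 = 0 := by rw [← h2]; norm_num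
  interval_cases x <;> interval_cases y <;> simp [xorNat, h]

section cellSum

variable {K : Type*} [Field K]

/-- The field element whose coordinates with respect to the powers of `ζ` are stored in the `m`
cells from `base` on. The powers may be linearly dependent. -/
def cellSum (ζ : K) (f : ℕ → ℕ) (base m : ℕ) : K := ∑ c ∈ Finset.range m, (f (base + c) : K) * ζ ^ c

theorem cellSum_congr (ζ : K) {f g : ℕ → ℕ} {base m : ℕ}
    (h : ∀ c < m, f (base + c) = g (base + c)) : cellSum ζ f base m = cellSum ζ g base m :=
  Finset.sum_congr rfl fun c hc => by rw [h c (Finset.mem_range.mp hc)]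

theorem cellSum_succ (ζ : K) (f : ℕ → ℕ) (base m : ℕ) :
    cellSum ζ f base (m + 1) = cellSum ζ f base m + (f (base + m) : K) * ζ ^ m :=
  Finset.sum_range_succ _ _

theorem cellSum_update (ζ : K) (f : ℕ → ℕ) {base m c v : ℕ} (hc : c < m) :
    cellSum ζ (Function.update f (base + c) v) base m =
      cellSum ζ f base m + ((v : K) - f (base + c)) * ζ ^ c := by
  have h1 : ∀ d ∈ Finset.range m, (Function.update f (base + c) v (base + d) : K) * ζ ^ d =
      (f (base + d) : K) * ζ ^ d + if d = c then ((v : K) - f (base + c)) * ζ ^ c else 0 := by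
    intro d _
    by_cases h : d = c
    · subst h
      simp
      ring
    · simp [h]
  rw [cellSum, Finset.sum_congr rfl h1, Finset.sum_add_distrib]
  simp [hc, cellSum]

end cellSum

/-- Adds the bit at address register `25` to the bit at address `register 20 + register 26`,
modulo two. -/
def xorCell : Prog :=
  .seq (.load 28 25) <| .seq (.add 29 20 26) <| .seq (.load 30 29) <| .seq (.sub 31 28 30) <|
    .seq (.sub 30 30 28) <| .seq (.add 30 31 30) (.store 29 30)

theorem xorCell_runs (s : State) : Runs xorCell s 7 (fun s' =>
    s'.mem = Function.update s.mem (s.reg 20 + s.reg 26)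
      (xorNat (s.mem (s.reg 25)) (s.mem (s.reg 20 + s.reg 26))) ∧
    s'.tape = s.tape ∧ ∀ r < 28, s'.reg r = s.reg r) := by
  refine Runs.load_seq (Runs.add_seq (Runs.load_seq (Runs.sub_seq (Runs.sub_seq (Runs.add_seq
    (Runs.store ⟨?_, rfl, ?_⟩))))))
  · simp [State.setReg_reg, xorNat]
  · intro r hr
    simp [State.setReg_reg, show ¬ r = 28 by omega, show ¬ r = 29 by omega,
      show ¬ r = 30 by omega, show ¬ r = 31 by omega]

/-- Moves to the next bit; the target position in register `26` is cyclic modulo register `11`. -/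
def advance : Prog :=
  .seq (.add 25 25 2) <| .seq (.add 26 26 2) <| .seq (.sub 27 27 2) <| .seq (.sub 31 11 26) <|
    .branch 31 (.const 31 0) (.const 26 0)

theorem advance_runs (s : State) (h2 : s.reg 2 = 1) (hpos : s.reg 26 < s.reg 11) :
    Runs advance s 6 (fun s' => s'.mem = s.mem ∧ s'.tape = s.tape ∧
      s'.reg 25 = s.reg 25 + 1 ∧ s'.reg 27 = s.reg 27 - 1 ∧
      (s'.reg 26 = s.reg 26 + 1 ∧ s.reg 26 + 1 < s.reg 11 ∨
        s'.reg 26 = 0 ∧ s.reg 26 + 1 = s.reg 11) ∧ ∀ r < 25, s'.reg r = s.reg r) := by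
  refine Runs.add_seq (Runs.add_seq (Runs.sub_seq (Runs.sub_seq (Runs.branch ?_ ?_))))
  · intro hne
    simp [State.setReg_reg, h2] at hne
    refine Runs.const ⟨rfl, rfl, ?_, ?_, Or.inl ⟨?_, by omega⟩, fun r hr => ?_⟩
    · simp [State.setReg_reg, h2]
    · simp [State.setReg_reg, h2]
    · simp [State.setReg_reg, h2]
    · simp [State.setReg_reg, show ¬ r = 25 by omega, show ¬ r = 26 by omega,
        show ¬ r = 27 by omega, show ¬ r = 31 by omega]
  · intro heq
    simp [State.setReg_reg, h2] at heq
    refine Runs.const ⟨rfl, rfl, ?_, ?_, Or.inr ⟨?_, by omega⟩, fun r hr => ?_⟩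
    · simp [State.setReg_reg, h2]
    · simp [State.setReg_reg, h2]
    · simp [State.setReg_reg]
    · simp [State.setReg_reg, show ¬ r = 25 by omega, show ¬ r = 26 by omega,
        show ¬ r = 27 by omega, show ¬ r = 31 by omega]

/-- Adds `ζ ^ j` times the element stored at register `16` to the one stored at register `20`,
where `j` is in register `22` and the arrays have the length in register `11`. -/
def addShifted : Prog :=
  .seq (.add 25 16 3) <| .seq (.add 26 22 3) <| .seq (.add 27 11 3) <|
    .loop 27 (.seq xorCell advance)

section
variable {K : Type*} [Field K]

theorem addShifted_runs (h2K : (2 : K) = 0) (ζ : K) (m j : ℕ) (hζ : ζ ^ m = 1) (s : State)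
    (h2 : s.reg 2 = 1) (h3 : s.reg 3 = 0) (hm : s.reg 11 = m) (hj : s.reg 22 = j) (hjm : j < m)
    (hZA : s.reg 16 + m ≤ s.reg 20) (hZ : ∀ c < m, s.mem (s.reg 16 + c) ≤ 1)
    (hA : ∀ c < m, s.mem (s.reg 20 + c) ≤ 1) :
    Runs addShifted s (14 * m + 4) (fun s' => (∀ r < 25, s'.reg r = s.reg r) ∧
      s'.tape = s.tape ∧
      (∀ a, a < s.reg 20 ∨ s.reg 20 + m ≤ a → s'.mem a = s.mem a) ∧
      (∀ c < m, s'.mem (s.reg 20 + c) ≤ 1) ∧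
      cellSum ζ s'.mem (s.reg 20) m =
        cellSum ζ s.mem (s.reg 20) m + ζ ^ j * cellSum ζ s.mem (s.reg 16) m) := by
  have hB : 14 * m + 4 = (m * (13 + 1) + 1) + 1 + 1 + 1 := by ring
  rw [hB]
  refine Runs.add_seq (Runs.add_seq (Runs.add_seq ?_))
  refine (Runs.loop m (fun i s' => (∀ r < 25, s'.reg r = s.reg r) ∧
      s'.tape = s.tape ∧
      (∀ a, a < s.reg 20 ∨ s.reg 20 + m ≤ a → s'.mem a = s.mem a) ∧
      (∀ c < m, s'.mem (s.reg 20 + c) ≤ 1) ∧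
      cellSum ζ s'.mem (s.reg 20) m =
        cellSum ζ s.mem (s.reg 20) m + ζ ^ j * cellSum ζ s.mem (s.reg 16) i ∧
      s'.reg 25 = s.reg 16 + i ∧ s'.reg 27 = m - i ∧
      s'.reg 26 < m ∧ ζ ^ s'.reg 26 = ζ ^ (i + j)) ?_ ?_ ?_).mono le_rfl ?_
  · refine ⟨?_, rfl, fun _ _ => rfl, hA, ?_, ?_, ?_, ?_, ?_⟩
    · intro r hr
      simp [State.setReg_reg, show ¬ r = 25 by omega, show ¬ r = 26 by omega,
        show ¬ r = 27 by omega]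
    · simp [cellSum]
    · simp [State.setReg_reg, h3]
    · simp [State.setReg_reg, h3, hm]
    · simp [State.setReg_reg, h3, hj, hjm]
    · simp [State.setReg_reg, h3, hj]
  · rintro i hi t ⟨t1, t2, t3, t4, t5, t6, t7, t8, t9⟩
    refine ⟨by omega, ?_⟩
    refine Runs.seq (B := 7) (C := 6) (xorCell_runs t) ?_
    rintro u ⟨u1, u2, u3⟩
    refine (advance_runs u ?_ ?_).mono le_rfl ?_
    · rw [u3 2 (by omega), t1 2 (by omega), h2]
    · rw [u3 26 (by omega), u3 11 (by omega), t1 11 (by omega), hm]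
      exact t8
    rintro w ⟨w1, w2, w3, w4, w5, w6⟩
    rw [u3 26 (by omega), u3 11 (by omega), t1 11 (by omega), hm] at w5
    rw [t1 20 (by omega), t6] at u1
    have hZi : t.mem (s.reg 16 + i) = s.mem (s.reg 16 + i) := t3 _ (by omega)
    rw [hZi] at u1
    refine ⟨?_, ?_, ?_, ?_, ?_, ?_, ?_, ?_, ?_⟩
    · intro r hr
      rw [w6 r hr, u3 r (by omega), t1 r hr]
    · rw [w2, u2, t2]
    · intro a ha
      rw [w1, u1, Function.update_of_ne (by omega), t3 a ha]
    · intro c hc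
      rw [w1, u1, Function.update_apply]
      split_ifs
      · exact xorNat_le_one (hZ i hi) (t4 _ t8)
      · exact t4 c hc
    · rw [w1, u1, cellSum_update ζ _ t8, xorNat_cast h2K (hZ i hi) (t4 _ t8), t5, t9,
        cellSum_succ]
      ring
    · rw [w3, u3 25 (by omega), t6, add_assoc]
    · rw [w4, u3 27 (by omega), t7]
      omega
    · rcases w5 with ⟨e1, e2⟩ | ⟨e1, e2⟩ <;> omega
    · rcases w5 with ⟨e1, e2⟩ | ⟨e1, e2⟩
      · rw [e1, pow_succ, t9]
        ring
      · have e3 : ζ ^ (i + 1 + j) = ζ ^ (t.reg 26) * ζ := by rw [t9]; ring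
        rw [e1, e3, ← pow_succ, e2, hζ, pow_zero]
  · rintro t ⟨-, -, -, -, -, -, t7, -⟩
    omega
  · rintro t ⟨t1, t2, t3, t4, t5, -⟩
    exact ⟨t1, t2, t3, t4, t5⟩

/-- Stores, in the fresh cells behind the element at register `16`, the product of this element
with the one stored at register `8`. -/
def multiply : Prog :=
  .seq (.add 20 16 11) <| .seq (.add 21 8 3) <| .seq (.const 22 0) <| .seq (.add 23 11 3) <|
    .loop 23 <| .seq (.load 24 21) <| .seq (.branch 24 addShifted (.const 24 0)) <|
      .seq (.add 21 21 2) <| .seq (.add 22 22 2) (.sub 23 23 2)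

theorem multiply_runs (h2K : (2 : K) = 0) (ζ : K) (m : ℕ) (hζ : ζ ^ m = 1) (s : State)
    (h2 : s.reg 2 = 1) (h3 : s.reg 3 = 0) (hm : s.reg 11 = m)
    (hXZ : s.reg 8 ≤ s.reg 16)
    (hX : ∀ c < m, s.mem (s.reg 8 + c) ≤ 1) (hZ : ∀ c < m, s.mem (s.reg 16 + c) ≤ 1)
    (hA : ∀ c < m, s.mem (s.reg 16 + m + c) = 0) :
    Runs multiply s (m * (14 * m + 10) + 5) (fun s' => (∀ r < 20, s'.reg r = s.reg r) ∧
      s'.tape = s.tape ∧ s'.reg 20 = s.reg 16 + m ∧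
      (∀ a, a < s.reg 16 + m ∨ s.reg 16 + m + m ≤ a → s'.mem a = s.mem a) ∧
      (∀ c < m, s'.mem (s.reg 16 + m + c) ≤ 1) ∧
      cellSum ζ s'.mem (s.reg 16 + m) m =
        cellSum ζ s.mem (s.reg 8) m * cellSum ζ s.mem (s.reg 16) m) := by
  have hB : m * (14 * m + 10) + 5 = (m * ((14 * m + 9) + 1) + 1) + 1 + 1 + 1 + 1 := by ring
  rw [hB]
  refine Runs.add_seq (Runs.add_seq (Runs.const_seq (Runs.add_seq ?_)))
  refine (Runs.loop m (fun i s' => (∀ r < 20, s'.reg r = s.reg r) ∧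
      s'.tape = s.tape ∧ s'.reg 20 = s.reg 16 + m ∧
      (∀ a, a < s.reg 16 + m ∨ s.reg 16 + m + m ≤ a → s'.mem a = s.mem a) ∧
      (∀ c < m, s'.mem (s.reg 16 + m + c) ≤ 1) ∧
      cellSum ζ s'.mem (s.reg 16 + m) m =
        cellSum ζ s.mem (s.reg 8) i * cellSum ζ s.mem (s.reg 16) m ∧
      s'.reg 21 = s.reg 8 + i ∧ s'.reg 22 = i ∧ s'.reg 23 = m - i) ?_ ?_ ?_).mono le_rfl ?_
  · refine ⟨?_, rfl, ?_, fun _ _ => rfl, ?_, ?_, ?_, ?_, ?_⟩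
    · intro r hr
      simp [State.setReg_reg, show ¬ r = 20 by omega, show ¬ r = 21 by omega,
        show ¬ r = 22 by omega, show ¬ r = 23 by omega]
    · simp [State.setReg_reg, hm]
    · intro c hc
      exact (hA c hc).le.trans zero_le_one
    · rw [cellSum]
      refine (Finset.sum_eq_zero fun c hc => ?_).trans (by simp [cellSum])
      simp [hA c (Finset.mem_range.mp hc)]
    · simp [State.setReg_reg, h3]
    · simp [State.setReg_reg]
    · simp [State.setReg_reg, h3, hm]
  · rintro i hi t ⟨t1, t2, t3, t4, t5, t6, t7, t8, t9⟩
    refine ⟨by omega, ?_⟩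
    have hXi : t.mem (s.reg 8 + i) = s.mem (s.reg 8 + i) := t4 _ (by omega)
    refine Runs.load_seq ?_
    rw [show 14 * m + 8 = (14 * m + 4) + 1 + 3 by ring]
    refine Runs.seq (Mid := fun s' => (∀ r < 24, s'.reg r = t.reg r) ∧
      s'.tape = s.tape ∧
      (∀ a, a < s.reg 16 + m ∨ s.reg 16 + m + m ≤ a → s'.mem a = s.mem a) ∧
      (∀ c < m, s'.mem (s.reg 16 + m + c) ≤ 1) ∧
      cellSum ζ s'.mem (s.reg 16 + m) m =
        cellSum ζ s.mem (s.reg 8) (i + 1) * cellSum ζ s.mem (s.reg 16) m) ?_ ?_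
    · rw [t7, hXi]
      refine Runs.branch ?_ ?_
      · intro hne
        simp only [State.setReg_reg, if_true] at hne
        have hone : s.mem (s.reg 8 + i) = 1 := by have := hX i hi; omega
        refine (addShifted_runs h2K ζ m i hζ _ ?_ ?_ ?_ ?_ hi ?_ ?_ ?_).mono le_rfl ?_
        · simp [State.setReg_reg, t1, h2]
        · simp [State.setReg_reg, t1, h3]
        · simp [State.setReg_reg, t1, hm]
        · simp [State.setReg_reg, t8]
        · simp [State.setReg_reg, t1, t3]
        · intro c hc
          simp only [State.setReg_reg, State.setReg_mem]
          rw [if_neg (by omega), t1 16 (by omega), t4 _ (by omega)]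
          exact hZ c hc
        · intro c hc
          simp only [State.setReg_reg, State.setReg_mem]
          rw [if_neg (by omega), t3]
          exact t5 c hc
        · simp only [State.setReg_reg, State.setReg_mem, State.setReg_tape]
          rw [if_neg (by omega), if_neg (by omega), t3, t1 16 (by omega)]
          rintro u ⟨u1, u2, u3, u4, u5⟩
          refine ⟨?_, u2.trans t2, ?_, u4, ?_⟩
          · intro r hr
            rw [u1 r (by omega), if_neg (by omega)]
          · intro a ha
            rw [u3 a ha, t4 a ha]
          · rw [u5, t6, cellSum_succ, hone, cellSum_congr ζ (fun c hc => t4 _ (by omega))]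
            push_cast
            ring
      · intro heq
        simp only [State.setReg_reg, if_true] at heq
        refine (Runs.const (Post := fun s' => _) ?_).mono (B := 1) (by omega) (fun _ h => h)
        refine ⟨?_, t2, t4, t5, ?_⟩
        · intro r hr
          simp [State.setReg_reg, show ¬ r = 24 by omega]
        · simp only [State.setReg_mem]
          rw [t6, cellSum_succ, heq]
          simp
    · rintro u ⟨u1, u2, u3, u4, u5⟩
      refine Runs.add_seq (Runs.add_seq (Runs.sub ⟨?_, u2, ?_, u3, u4, u5, ?_, ?_, ?_⟩))
      · intro r hr
        simp [State.setReg_reg, show ¬ r = 21 by omega, show ¬ r = 22 by omega,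
          show ¬ r = 23 by omega, u1 r (by omega), t1 r hr]
      · simp [State.setReg_reg, u1, t3]
      · simp [State.setReg_reg, u1, t7, t1 2, h2, add_assoc]
      · simp [State.setReg_reg, u1, t8, t1 2, h2]
      · simp [State.setReg_reg, u1, t9, t1 2, h2]
        omega
  · rintro t ⟨-, -, -, -, -, -, -, -, t9⟩
    omega
  · rintro t ⟨t1, t2, t3, t4, t5, t6, -⟩
    exact ⟨t1, t2, t3, t4, t5, t6⟩

end

end RandRAM

/-! ### The program -/

namespace RandRAM

/-- The bit number `i` of `ω`, as a natural number; `0` beyond the end. -/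
def bitAt {r : ℕ} (ω : Fin r → Bool) (i : ℕ) : ℕ := if h : i < r then (ω ⟨i, h⟩).toNat else 0

theorem bitAt_le_one {r : ℕ} (ω : Fin r → Bool) (i : ℕ) : bitAt ω i ≤ 1 := by
  unfold bitAt
  split_ifs
  · exact Bool.toNat_le _
  · exact zero_le_one

/-- Reads twice as many random bits as register `11` says into the cells behind register `8`. -/
def readBits : Prog :=
  .seq (.add 13 8 3) <| .seq (.add 14 11 11) <| .loop 14 <|
    .seq (.coin 15) <| .seq (.store 13 15) <| .seq (.add 13 13 2) (.sub 14 14 2)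

theorem readBits_runs {r : ℕ} (ω : Fin r → Bool) (s : State) (h2 : s.reg 2 = 1)
    (h3 : s.reg 3 = 0) (hr : s.reg 11 + s.reg 11 = r) (htape : s.tape = List.ofFn ω) :
    Runs readBits s (5 * r + 3) (fun s' => (∀ q < 13, s'.reg q = s.reg q) ∧
      (∀ i < r, s'.mem (s.reg 8 + i) = bitAt ω i) ∧
      ∀ a, a < s.reg 8 ∨ s.reg 8 + r ≤ a → s'.mem a = s.mem a) := by
  have hB : 5 * r + 3 = (r * (4 + 1) + 1) + 1 + 1 := by ring
  rw [hB]
  refine Runs.add_seq (Runs.add_seq ?_)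
  refine (Runs.loop r (fun i s' => s'.reg 14 = r - i ∧ s'.reg 13 = s.reg 8 + i ∧
      s'.tape = (List.ofFn ω).drop i ∧ (∀ q < 13, s'.reg q = s.reg q) ∧
      (∀ j < i, s'.mem (s.reg 8 + j) = bitAt ω j) ∧
      ∀ a, a < s.reg 8 ∨ s.reg 8 + r ≤ a → s'.mem a = s.mem a) ?_ ?_ ?_).mono le_rfl ?_
  · refine ⟨?_, ?_, by simpa using htape, ?_, fun j hj => absurd hj (Nat.not_lt_zero j),
      fun _ _ => rfl⟩
    · simp [State.setReg_reg, hr]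
    · simp [State.setReg_reg, h3]
    · intro q hq
      simp [State.setReg_reg, show ¬ q = 13 by omega, show ¬ q = 14 by omega]
  · rintro i hi t ⟨t1, t2, t3, t4, t5, t6⟩
    refine ⟨by omega, ?_⟩
    have hlen : i < (List.ofFn ω).length := by simpa using hi
    rw [List.drop_eq_getElem_cons hlen, List.getElem_ofFn] at t3
    refine Runs.coin_seq t3 (Runs.store_seq (Runs.add_seq (Runs.sub ⟨?_, ?_, rfl, ?_, ?_, ?_⟩)))
    · simp [State.setReg_reg, t1, t4 2, h2]
      omega
    · simp [State.setReg_reg, t2, t4 2, h2, add_assoc]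
    · intro q hq
      simp [State.setReg_reg, show ¬ q = 13 by omega, show ¬ q = 14 by omega,
        show ¬ q = 15 by omega, t4 q hq]
    · intro j hj
      by_cases hji : j = i
      · subst hji
        simp [State.setReg_reg, t2, bitAt, hi]
      · simp [State.setReg_reg, t2, hji, t5 j (by omega)]
    · intro a ha
      have : ¬ a = s.reg 8 + i := by omega
      simp [State.setReg_reg, t2, this, t6 a ha]
  · rintro t ⟨t1, -⟩
    omega
  · rintro t ⟨-, -, -, t4, t5, t6⟩
    exact ⟨t4, t5, t6⟩

/-- Writes to the address in register `17` the sum modulo two of the coordinates number `0` and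
number `register 10` of the element stored at register `16`. -/
def outputBit : Prog :=
  .seq (.load 20 16) <| .seq (.add 21 16 10) <| .seq (.load 21 21) <| .seq (.sub 22 20 21) <|
    .seq (.sub 21 21 20) <| .seq (.add 21 22 21) (.store 17 21)

theorem outputBit_runs (s : State) : Runs outputBit s 7 (fun s' =>
    s'.mem = Function.update s.mem (s.reg 17)
      (xorNat (s.mem (s.reg 16)) (s.mem (s.reg 16 + s.reg 10))) ∧
    ∀ r < 20, s'.reg r = s.reg r) := by
  refine Runs.load_seq (Runs.add_seq (Runs.load_seq (Runs.sub_seq (Runs.sub_seq (Runs.add_seq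
    (Runs.store ⟨?_, ?_⟩))))))
  · simp [State.setReg_reg, xorNat]
  · intro r hr
    simp [State.setReg_reg, show ¬ r = 20 by omega, show ¬ r = 21 by omega,
      show ¬ r = 22 by omega]

/-- With field elements `x` at register `8` and `y` behind it, computes `y * x ^ i` for all `i`
below register `8` and writes one bit of it to address `i`. -/
def powers : Prog :=
  .seq (.add 16 8 11) <| .seq (.const 17 0) <| .seq (.add 18 8 3) <|
    .loop 18 <| .seq outputBit <| .seq multiply <| .seq (.add 16 20 3) <|
      .seq (.add 17 17 2) (.sub 18 18 2)

section
variable {K : Type*} [Field K] [Algebra (ZMod 2) K]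

theorem two_eq_zero_of_algebra : (2 : K) = 0 := by
  have h : algebraMap (ZMod 2) K 2 = 0 := by
    rw [show (2 : ZMod 2) = 0 by decide, map_zero]
  rwa [map_ofNat] at h

theorem map_cellSum (μ : K →ₗ[ZMod 2] ZMod 2) (ζ : K) {m h : ℕ} (h0 : 0 < h) (hm : h < m)
    (hμ : ∀ c < m, μ (ζ ^ c) = if c = 0 ∨ c = h then 1 else 0) (f : ℕ → ℕ) (base : ℕ) :
    μ (cellSum ζ f base m) = f (base + h) + f base := by
  have h1 : ∀ c ∈ Finset.range m, μ ((f (base + c) : K) * ζ ^ c) =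
      (if c = h then (f (base + h) : ZMod 2) else 0) +
        if c = 0 then (f base : ZMod 2) else 0 := by
    intro c hc
    rw [← nsmul_eq_mul, map_nsmul, hμ c (Finset.mem_range.mp hc), nsmul_eq_mul]
    by_cases hc0 : c = 0
    · subst hc0
      simp [h0.ne]
    · by_cases hch : c = h
      · subst hch
        simp [hc0]
      · simp [hc0, hch]
  rw [cellSum, map_sum, Finset.sum_congr rfl h1, Finset.sum_add_distrib]
  simp [hm, h0.trans hm]

theorem xorNat_eq_zero_iff {x y : ℕ} (hx : x ≤ 1) (hy : y ≤ 1) :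
    xorNat x y = 0 ↔ (y + x : ZMod 2) = 0 := by
  rw [← xorNat_cast (R := ZMod 2) (by decide) hx hy]
  have := xorNat_le_one hx hy
  interval_cases xorNat x y <;> simp

theorem powers_runs (μ : K →ₗ[ZMod 2] ZMod 2) (ζ : K) (n m h : ℕ) (hζ : ζ ^ m = 1) (h0 : 0 < h)
    (hhm : h < m) (hμ : ∀ c < m, μ (ζ ^ c) = if c = 0 ∨ c = h then 1 else 0) (s : State)
    (h2 : s.reg 2 = 1) (h3 : s.reg 3 = 0) (h8 : s.reg 8 = n) (h10 : s.reg 10 = h)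
    (h11 : s.reg 11 = m) (hbits : ∀ i < m + m, s.mem (n + i) ≤ 1)
    (hzero : ∀ a, n + (m + m) ≤ a → s.mem a = 0) :
    Runs powers s (n * (m * (14 * m + 10) + 16) + 4) (fun s' => (∀ r < 16, s'.reg r = s.reg r) ∧
      ∀ i < n, s'.mem i = 0 ↔
        μ (cellSum ζ s.mem (n + m) m * cellSum ζ s.mem n m ^ i) = 0) := by
  have hB : n * (m * (14 * m + 10) + 16) + 4 =
      (n * ((m * (14 * m + 10) + 15) + 1) + 1) + 1 + 1 + 1 := by ring
  rw [hB]
  refine Runs.add_seq (Runs.const_seq (Runs.add_seq ?_))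
  refine (Runs.loop n (fun i s' => (∀ r < 16, s'.reg r = s.reg r) ∧
      s'.reg 16 = n + m + i * m ∧ s'.reg 17 = i ∧ s'.reg 18 = n - i ∧
      (∀ c < m, s'.mem (n + c) = s.mem (n + c)) ∧
      (∀ c < m, s'.mem (n + m + i * m + c) ≤ 1) ∧
      cellSum ζ s'.mem (n + m + i * m) m =
        cellSum ζ s.mem (n + m) m * cellSum ζ s.mem n m ^ i ∧
      (∀ a, n + m + i * m + m ≤ a → s'.mem a = 0) ∧
      ∀ j < i, s'.mem j = 0 ↔
        μ (cellSum ζ s.mem (n + m) m * cellSum ζ s.mem n m ^ j) = 0) ?_ ?_ ?_).mono le_rfl ?_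
  · refine ⟨?_, ?_, ?_, ?_, fun _ _ => rfl, ?_, ?_, ?_, fun j hj => absurd hj (Nat.not_lt_zero j)⟩
    · intro r hr
      simp [State.setReg_reg, show ¬ r = 16 by omega, show ¬ r = 17 by omega,
        show ¬ r = 18 by omega]
    · simp [State.setReg_reg, h8, h11]
    · simp [State.setReg_reg]
    · simp [State.setReg_reg, h8, h3]
    · intro c hc
      simp only [State.setReg_mem, zero_mul, add_zero]
      rw [add_assoc]
      exact hbits _ (by omega)
    · simp
    · intro a ha
      exact hzero a (by omega)
  · rintro i hi t ⟨t1, t2, t3, t4, t5, t6, t7, t8, t9⟩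
    refine ⟨by omega, ?_⟩
    rw [show m * (14 * m + 10) + 15 = 7 + ((m * (14 * m + 10) + 5) + 3) by ring]
    refine Runs.seq (outputBit_runs t) ?_
    rintro u ⟨u1, u2⟩
    rw [t1 10 (by omega), h10, t2, t3] at u1
    have hu : ∀ a, a ≠ i → u.mem a = t.mem a := fun a ha => by
      rw [u1, Function.update_of_ne ha]
    have u8 : u.reg 8 = n := by rw [u2 8 (by omega), t1 8 (by omega), h8]
    have u11 : u.reg 11 = m := by rw [u2 11 (by omega), t1 11 (by omega), h11]
    have u16 : u.reg 16 = n + m + i * m := by rw [u2 16 (by omega), t2]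
    have hmul := multiply_runs two_eq_zero_of_algebra ζ m hζ u
      (by rw [u2 2 (by omega), t1 2 (by omega), h2])
      (by rw [u2 3 (by omega), t1 3 (by omega), h3]) u11
      (by rw [u8, u16]; omega)
      (fun c hc => by
        rw [u8, hu _ (by omega), t5 c hc]
        exact hbits c (by omega))
      (fun c hc => by
        rw [u16, hu _ (by omega)]
        exact t6 c hc)
      (fun c hc => by
        rw [u16, hu _ (by omega)]
        exact t8 _ (by omega))
    refine Runs.seq hmul ?_
    rw [u8, u16]
    rintro v ⟨v1, -, v3, v4, v5, v6⟩
    have hnext : n + m + (i + 1) * m = n + m + i * m + m := by ring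
    have v31 : v.reg 3 = 0 := by
      rw [v1 3 (by omega), u2 3 (by omega), t1 3 (by omega), h3]
    have v21 : v.reg 2 = 1 := by
      rw [v1 2 (by omega), u2 2 (by omega), t1 2 (by omega), h2]
    have v17 : v.reg 17 = i := by rw [v1 17 (by omega), u2 17 (by omega), t3]
    have v18 : v.reg 18 = n - i := by rw [v1 18 (by omega), u2 18 (by omega), t4]
    refine Runs.add_seq (Runs.add_seq (Runs.sub ⟨?_, ?_, ?_, ?_, ?_, ?_, ?_, ?_, ?_⟩))
    · intro r hr
      simp only [State.setReg_reg]
      rw [if_neg (by omega), if_neg (by omega), if_neg (by omega), v1 r (by omega),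
        u2 r (by omega), t1 r hr]
    · rw [hnext]
      simp [State.setReg_reg, v3, v31]
    · simp [State.setReg_reg, v17, v21]
    · simp [State.setReg_reg, v18, v21]
      omega
    · intro c hc
      simp only [State.setReg_mem]
      rw [v4 _ (by omega), hu _ (by omega), t5 c hc]
    · rw [hnext]
      exact v5
    · rw [hnext]
      simp only [State.setReg_mem]
      rw [v6, cellSum_congr ζ (fun c hc => (hu (n + m + i * m + c) (by omega))),
        cellSum_congr ζ (fun c hc => (hu (n + c) (by omega)).trans (t5 c hc)), t7]
      ring
    · intro a ha
      rw [hnext] at ha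
      simp only [State.setReg_mem]
      rw [v4 _ (by omega), hu _ (by omega)]
      exact t8 _ (by omega)
    · intro j hj
      simp only [State.setReg_mem]
      rw [v4 _ (by omega)]
      by_cases hji : j = i
      · subst hji
        rw [u1, Function.update_self, xorNat_eq_zero_iff, ← t7, map_cellSum μ ζ h0 hhm hμ]
        · simpa using t6 0 (by omega)
        · exact t6 h hhm
      · rw [hu _ hji]
        exact t9 j (by omega)
  · rintro t ⟨-, -, -, t4, -⟩
    omega
  · rintro t ⟨t1, -, -, -, -, -, -, -, t9⟩
    exact ⟨t1, t9⟩

end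

/-- Computes the parameters of the matrix: with `L` and `e` the least numbers such that
`N ≤ k 3^L` and `k ≤ 3^e`, leaves `e`, `k L`, the number `Q = cQ k L` of rows, and `Q N` in the
registers `5` to `8`. -/
def setup (cQ : ℕ) : Prog :=
  .seq (.const 2 1) <| .seq (.add 13 1 3) <| .seq (triplingProg 4 0) <| .seq (.const 13 1) <|
    .seq (triplingProg 5 1) <| .seq (mulProg 6 1 4) <| .seq (.const 12 cQ) <|
      .seq (mulProg 7 12 6) (mulProg 8 7 0)

theorem setup_runs (cQ N k G : ℕ) (hk : 1 ≤ k) {r : ℕ} (ω : Fin r → Bool) (hN : N ≤ G)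
    (hkG : k ≤ G) (hL : triplings k N ≤ G) (hkL : k * triplings k N ≤ G) :
    Runs (setup cQ) (init N k ω) (19 * G + 19) (fun s => s.reg 2 = 1 ∧ s.reg 3 = 0 ∧
      s.reg 5 = triplings 1 k ∧ s.reg 6 = k * triplings k N ∧
      s.reg 7 = cQ * (k * triplings k N) ∧ s.reg 8 = cQ * (k * triplings k N) * N ∧
      (∀ a, s.mem a = 0) ∧ s.tape = List.ofFn ω) := by
  have hB : 19 * G + 19 = ((5 * G + 3) + (((5 * G + 3) + ((3 * G + 3) + (((3 * G + 3) +
    (3 * G + 3)) + 1))) + 1)) + 1 + 1 := by ring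
  rw [hB]
  refine Runs.const_seq (Runs.add_seq ?_)
  refine Runs.seq ((triplingProg_runs _ 4 0 (by omega) (by omega) (by omega) (by omega)
    (by simp [State.setReg_reg]) (by simpa [State.setReg_reg, init] using hk)).mono
    (by simpa [State.setReg_reg, init] using hN) (fun _ h => h)) ?_
  simp only [State.setReg_reg, init, reduceIte, Nat.reduceEqDiff,
    State.setReg_mem, State.setReg_tape, add_zero]
  rintro s ⟨s1, -, s3, s4, s5⟩
  have s0 : s.reg 0 = N := by simp [s5]
  have s01 : s.reg 1 = k := by simp [s5]
  have s02 : s.reg 2 = 1 := by simp [s5]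
  have s03 : s.reg 3 = 0 := by simp [s5]
  clear s5
  refine Runs.const_seq ?_
  refine Runs.seq ((triplingProg_runs _ 5 1 (by omega) (by omega) (by omega) (by omega)
    (by simp [State.setReg_reg, s02]) (by simp [State.setReg_reg])).mono
    (by simpa [State.setReg_reg, s01] using hkG) (fun _ h => h)) ?_
  simp only [State.setReg_reg, State.setReg_mem, State.setReg_tape]
  rintro t ⟨t1, -, t3, t4, t5⟩
  have t0 : t.reg 0 = N := by simp [t5, s0]
  have t01 : t.reg 1 = k := by simp [t5, s01]
  have t02 : t.reg 2 = 1 := by simp [t5, s02]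
  have t03 : t.reg 3 = 0 := by simp [t5, s03]
  have t04 : t.reg 4 = triplings k N := by simpa [t5] using s1
  have t05 : t.reg 5 = triplings 1 k := by simpa [s01] using t1
  clear t5 t1
  refine Runs.seq ((mulProg_runs t 6 1 4 (by omega) (by omega) (by omega) t02 t03
    (by omega)).mono (by rw [t04]; omega) (fun _ h => h)) ?_
  rintro u ⟨u1, u3, u4, u5⟩
  rw [t01, t04] at u1
  refine Runs.const_seq ?_
  refine Runs.seq ((mulProg_runs _ 7 12 6 (by omega) (by omega) (by omega)
    (by simp [State.setReg_reg, u5, t02]) (by simp [State.setReg_reg, u5, t03])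
    (by omega)).mono (by simpa [State.setReg_reg, u1] using hkL) (fun _ h => h)) ?_
  simp only [State.setReg_reg, State.setReg_mem, State.setReg_tape]
  rintro v ⟨v1, v3, v4, v5⟩
  have v02 : v.reg 2 = 1 := by simp [v5, u5, t02]
  have v03 : v.reg 3 = 0 := by simp [v5, u5, t03]
  have v0 : v.reg 0 = N := by simp [v5, u5, t0]
  have v05 : v.reg 5 = triplings 1 k := by simp [v5, u5, t05]
  have v06 : v.reg 6 = k * triplings k N := by simp [v5, u1]
  have v07 : v.reg 7 = cQ * (k * triplings k N) := by simpa [u1] using v1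
  refine (mulProg_runs v 8 7 0 (by omega) (by omega) (by omega) v02 v03 (by omega)).mono
    (by rw [v0]; omega) ?_
  rintro w ⟨w1, w3, w4, w5⟩
  refine ⟨by simp [w5, v02], by simp [w5, v03], by simp [w5, v05], by simp [w5, v06],
    by simp [w5, v07], by rw [w1, v07, v0], ?_, ?_⟩
  · intro a
    rw [w3, v3, u3, t3, s3]
  · rw [w4, v4, u4, t4, s4]

/-- Chooses the degree `2 h`, with `h` the least power of `3` that is at least
`cM * register 6 * register 5`, of the field with two generators, reads two of its elements from
the tape, and writes the signs. -/
def fillMatrix (cM : ℕ) : Prog :=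
  .seq (.const 12 cM) <| .seq (mulProg 9 12 6) <| .seq (mulProg 9 5 9) <| .seq (.const 13 1) <|
    .seq (triplingProg 12 9) <| .seq (.add 10 13 3) <| .seq (.add 11 10 10) <|
      .seq (.add 11 11 10) <| .seq readBits powers

section
variable {K : Type*} [Field K] [Algebra (ZMod 2) K]

theorem fillMatrix_runs (cM n m h e kL G : ℕ) (μ : K →ₗ[ZMod 2] ZMod 2) (ζ : K)
    (hh : h = 3 ^ triplings 1 (e * (cM * kL))) (hm : m = 3 * h) (hζ : ζ ^ m = 1)
    (hμ : ∀ c < m, μ (ζ ^ c) = if c = 0 ∨ c = h then 1 else 0)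
    (ω : Fin (m + m) → Bool) (s : State)
    (h2 : s.reg 2 = 1) (h3 : s.reg 3 = 0) (h5 : s.reg 5 = e) (h6 : s.reg 6 = kL)
    (h8 : s.reg 8 = n) (hmem : ∀ a, s.mem a = 0) (htape : s.tape = List.ofFn ω)
    (hG1 : kL ≤ G) (hG2 : cM * kL ≤ G) (hG3 : e * (cM * kL) ≤ G) (hG4 : m ≤ G) (hG5 : n ≤ G) :
    Runs (fillMatrix cM) s (G * (G * (14 * G + 10) + 16) + 21 * G + 21) (fun s' =>
      s'.reg 3 = 0 ∧ s'.reg 7 = s.reg 7 ∧ ∀ i < n, s'.mem i = 0 ↔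
        μ (cellSum ζ (bitAt ω) m m * cellSum ζ (bitAt ω) 0 m ^ i) = 0) := by
  have h0 : 0 < h := by rw [hh]; positivity
  have hPW : n * (m * (14 * m + 10) + 16) + 4 ≤ G * (G * (14 * G + 10) + 16) + 4 := by gcongr
  have hB : G * (G * (14 * G + 10) + 16) + 21 * G + 21 = ((3 * G + 3) + ((3 * G + 3) +
    (((5 * G + 3) + (((10 * G + 3) + (G * (G * (14 * G + 10) + 16) + 4)) + 1 + 1 + 1)) +
    1))) + 1 := by ring
  rw [hB]
  refine Runs.const_seq ?_
  refine Runs.seq ((mulProg_runs _ 9 12 6 (by omega) (by omega) (by omega)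
    (by simp [State.setReg_reg, h2]) (by simp [State.setReg_reg, h3])
    (by omega)).mono (by simpa [State.setReg_reg, h6] using hG1) (fun _ h => h)) ?_
  simp only [State.setReg_reg, State.setReg_mem, State.setReg_tape]
  rintro t ⟨t1, t3, t4, t5⟩
  have t9 : t.reg 9 = cM * kL := by simpa [h6] using t1
  have t05 : t.reg 5 = e := by simp [t5, h5]
  refine Runs.seq ((mulProg_runs t 9 5 9 (by omega) (by omega) (by omega)
    (by simp [t5, h2]) (by simp [t5, h3])
    (by omega)).mono (by rw [t9]; omega) (fun _ h => h)) ?_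
  rintro u ⟨u1, u3, u4, u5⟩
  rw [t05, t9] at u1
  refine Runs.const_seq ?_
  refine Runs.seq ((triplingProg_runs _ 12 9 (by omega) (by omega) (by omega) (by omega)
    (by simp [State.setReg_reg, u5, t5, h2]) (by simp [State.setReg_reg])).mono
    (by simpa [State.setReg_reg, u1] using hG3) (fun _ h => h)) ?_
  simp only [State.setReg_reg, State.setReg_mem, State.setReg_tape]
  rintro v ⟨-, v2, v3, v4, v5⟩
  have v13 : v.reg 13 = h := by simpa [u1, ← hh] using v2
  have v02 : v.reg 2 = 1 := by simp [v5, u5, t5, h2]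
  have v03 : v.reg 3 = 0 := by simp [v5, u5, t5, h3]
  have v07 : v.reg 7 = s.reg 7 := by simp [v5, u5, t5]
  have v08 : v.reg 8 = n := by simp [v5, u5, t5, h8]
  have vm : ∀ a, v.mem a = 0 := fun a => by rw [v3, u3, t3, hmem]
  refine Runs.add_seq (Runs.add_seq (Runs.add_seq ?_))
  refine Runs.seq ((readBits_runs ω _ (by simp [State.setReg_reg, v02])
    (by simp [State.setReg_reg, v03]) (by simp [State.setReg_reg, v13, v03, hm]; ring)
    (by simp [v4, u4, t4, htape])).mono (by omega) (fun _ h => h)) ?_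
  simp only [State.setReg_reg, State.setReg_mem]
  rintro w ⟨w1, w2, w3⟩
  have w02 : w.reg 2 = 1 := by simp [w1, v02]
  have w03 : w.reg 3 = 0 := by simp [w1, v03]
  have w07 : w.reg 7 = s.reg 7 := by simp [w1, v07]
  have w08 : w.reg 8 = n := by simp [w1, v08]
  have w10 : w.reg 10 = h := by simp [w1, v13, v03]
  have w11 : w.reg 11 = m := by simp [w1, v13, v03, hm]; ring
  have wbit : ∀ i < m + m, w.mem (n + i) = bitAt ω i := by simpa [v08] using w2
  refine (powers_runs μ ζ n m h hζ h0 (by omega) hμ w w02 w03 w08 w10 w11 ?_ ?_).mono hPW ?_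
  · intro i hi
    rw [wbit i hi]
    exact bitAt_le_one ω i
  · intro a ha
    rw [w3 a (by simp [v08]; omega), vm]
  · rintro z ⟨z1, z2⟩
    refine ⟨by rw [z1 3 (by omega), w03], by rw [z1 7 (by omega), w07], ?_⟩
    have e1 : cellSum ζ w.mem (n + m) m = cellSum ζ (bitAt ω) m m :=
      Finset.sum_congr rfl fun c hc => by
        rw [add_assoc, wbit _ (by have := Finset.mem_range.mp hc; omega)]
    have e2 : cellSum ζ w.mem n m = cellSum ζ (bitAt ω) 0 m :=
      Finset.sum_congr rfl fun c hc => by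
        rw [zero_add, wbit _ (by have := Finset.mem_range.mp hc; omega)]
    rw [e1, e2] at z2
    exact z2

end

/-- The algorithm. For `k = 1` register `5` is zero, and the matrix with all signs positive is
already in memory. -/
def matrixProg (cQ cM : ℕ) : Prog :=
  .seq (setup cQ) <| .seq (.branch 5 (fillMatrix cM) (.const 12 0)) (.add 0 7 3)

open Polynomial in
/-- A polynomial bound for the running time. -/
noncomputable def timeBound (cQ cM : ℕ) : Polynomial ℕ :=
  C 100 * (C (cQ + 9 * cM + 1) * X ^ 3 + 1) ^ 3

theorem three_pow_triplings_le {M : ℕ} (hM : 1 ≤ M) : 3 ^ triplings 1 M ≤ 3 * M := by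
  rcases Nat.eq_zero_or_eq_succ_pred (triplings 1 M) with h | h
  · rw [h]; omega
  · have h1 := lt_of_lt_triplings (a := 1) (T := M) (e := (triplings 1 M).pred) (by omega)
    rw [h, Nat.succ_eq_add_one, pow_succ]
    omega

theorem timeBound_ge {cQ cM N G : ℕ} (hG : G = (cQ + 9 * cM + 1) * N ^ 3) :
    (19 * G + 19) + (((G * (G * (14 * G + 10) + 16) + 21 * G + 21) + 1) + 1) ≤
      (timeBound cQ cM).eval N := by
  have h : (timeBound cQ cM).eval N = 100 * (G + 1) ^ 3 := by
    simp [timeBound, hG]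
  rw [h]
  nlinarith [Nat.zero_le G, Nat.zero_le (G ^ 2), Nat.zero_le (G ^ 3)]

theorem matrixProg_outputs_one (cQ cM N : ℕ) (hN : 1 ≤ N) {r : ℕ} (ω : Fin r → Bool) :
    Outputs (matrixProg cQ cM) N 1 ω ((timeBound cQ cM).eval N)
      (cQ * (1 * triplings 1 N)) (fun _ => 1) := by
  obtain ⟨G, hG⟩ : ∃ G, G = (cQ + 9 * cM + 1) * N ^ 3 := ⟨_, rfl⟩
  have hNG : N ≤ G := by
    rw [hG]
    exact (Nat.le_self_pow (by norm_num) N).trans (Nat.le_mul_of_pos_left _ (by omega))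
  have hL := triplings_le 1 N le_rfl
  have hrun : Runs (matrixProg cQ cM) (init N 1 ω)
      ((19 * G + 19) + (((G * (G * (14 * G + 10) + 16) + 21 * G + 21) + 1) + 1))
      (fun s => s.reg 0 = cQ * (1 * triplings 1 N) ∧ ∀ a, s.mem a = 0) := by
    refine Runs.seq (setup_runs cQ N 1 G le_rfl ω hNG (hN.trans hNG) (hL.trans hNG)
      (by omega)) ?_
    rintro s ⟨s2, s3, s5, s6, s7, s8, sm, -⟩
    have h5 : s.reg 5 = 0 := by
      rw [s5]
      exact Nat.le_zero.mp (Nat.sInf_le (by simp))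
    refine Runs.seq (Mid := fun s' => s'.reg 3 = 0 ∧ s'.reg 7 = s.reg 7 ∧ ∀ a, s'.mem a = 0)
      (Runs.branch (fun h => absurd h5 h) (fun _ => ?_)) ?_
    · refine Runs.mono (B := 1) (Runs.const (Post := fun s' => s'.reg 3 = 0 ∧
        s'.reg 7 = s.reg 7 ∧ ∀ a, s'.mem a = 0) ⟨?_, ?_, sm⟩) (by omega) (fun _ h => h)
      · simp [State.setReg_reg, s3]
      · simp [State.setReg_reg]
    · rintro t ⟨t3, t7, tm⟩
      exact Runs.add ⟨by simp [State.setReg_reg, t3, t7, s7], tm⟩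
  obtain ⟨t, ht, s, he, hs0, hsm⟩ := hrun
  exact ⟨t, ht.trans (timeBound_ge hG), s, he, hs0, fun i j => by simp [hsm]⟩

theorem matrixProg_outputs {K : Type*} [Field K] [Algebra (ZMod 2) K] (cQ cM N k m h : ℕ)
    (hcM : 1 ≤ cM) (hk : 2 ≤ k) (hkN : k < N)
    (μ : K →ₗ[ZMod 2] ZMod 2) (ζ : K)
    (hh : h = 3 ^ triplings 1 (triplings 1 k * (cM * (k * triplings k N)))) (hm : m = 3 * h)
    (hζ : ζ ^ m = 1)
    (hμ : ∀ c < m, μ (ζ ^ c) = if c = 0 ∨ c = h then 1 else 0)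
    (ω : Fin (m + m) → Bool) :
    Outputs (matrixProg cQ cM) N k ω ((timeBound cQ cM).eval N)
      (cQ * (k * triplings k N)) (fun ij => bitSign (μ (cellSum ζ (bitAt ω) m m *
        cellSum ζ (bitAt ω) 0 m ^ ((ij.1 : ℕ) * N + (ij.2 : ℕ))))) := by
  obtain ⟨G, hG⟩ : ∃ G, G = (cQ + 9 * cM + 1) * N ^ 3 := ⟨_, rfl⟩
  have hL := triplings_le k N (by omega)
  have he := triplings_le 1 k le_rfl
  have hL0 : 1 ≤ triplings k N := by
    by_contra hcon
    have h1 := triplings_spec k N (by omega)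
    rw [show triplings k N = 0 by omega] at h1
    omega
  have he0 : 1 ≤ triplings 1 k := by
    by_contra hcon
    have h1 := triplings_spec 1 k le_rfl
    rw [show triplings 1 k = 0 by omega] at h1
    omega
  generalize hLdef : triplings k N = L at *
  generalize hedef : triplings 1 k = e at *
  have hN1 : 1 ≤ N := by omega
  have hN2 : N ≤ N ^ 2 := Nat.le_self_pow (by norm_num) N
  have hN3 : N ^ 2 ≤ N ^ 3 := Nat.pow_le_pow_right hN1 (by norm_num)
  have hkL : k * L ≤ N ^ 2 := by rw [sq]; exact Nat.mul_le_mul hkN.le hL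
  have hN3G : N ^ 3 ≤ G := by rw [hG]; exact Nat.le_mul_of_pos_left _ (by omega)
  have hM : e * (cM * (k * L)) ≤ cM * N ^ 3 := by
    calc e * (cM * (k * L)) ≤ N * (cM * N ^ 2) := by gcongr; omega
      _ = cM * N ^ 3 := by ring
  have hM0 : 1 ≤ e * (cM * (k * L)) :=
    Nat.one_le_iff_ne_zero.mpr (by simp only [ne_eq, mul_eq_zero]; omega)
  have hcMG : 9 * (cM * N ^ 3) ≤ G := by
    rw [hG, ← mul_assoc]
    exact Nat.mul_le_mul_right _ (by omega)
  have hmG : m ≤ G := by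
    have := three_pow_triplings_le hM0
    rw [← hh] at this
    omega
  have hnG : cQ * (k * L) * N ≤ G := by
    calc cQ * (k * L) * N ≤ cQ * N ^ 2 * N := by gcongr
      _ = cQ * N ^ 3 := by ring
      _ ≤ G := by rw [hG]; exact Nat.mul_le_mul_right _ (by omega)
  have hG2 : cM * (k * L) ≤ G := by
    calc cM * (k * L) ≤ cM * N ^ 3 := by gcongr; omega
      _ ≤ G := by omega
  have hrun : Runs (matrixProg cQ cM) (init N k ω)
      ((19 * G + 19) + (((G * (G * (14 * G + 10) + 16) + 21 * G + 21) + 1) + 1))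
      (fun s => s.reg 0 = cQ * (k * L) ∧ ∀ i < cQ * (k * L) * N, s.mem i = 0 ↔
        μ (cellSum ζ (bitAt ω) m m * cellSum ζ (bitAt ω) 0 m ^ i) = 0) := by
    refine Runs.seq (setup_runs cQ N k G (by omega) ω (by omega) (by omega) (by omega)
      (by rw [hLdef]; omega)) ?_
    rw [hLdef, hedef]
    rintro s ⟨s2, s3, s5, s6, s7, s8, sm, st⟩
    refine Runs.seq (Mid := fun s' => s'.reg 3 = 0 ∧ s'.reg 7 = s.reg 7 ∧
      ∀ i < cQ * (k * L) * N, s'.mem i = 0 ↔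
        μ (cellSum ζ (bitAt ω) m m * cellSum ζ (bitAt ω) 0 m ^ i) = 0)
      (Runs.branch (fun _ => ?_) (fun h => by omega)) ?_
    · exact fillMatrix_runs cM (cQ * (k * L) * N) m h e (k * L) G μ ζ hh hm hζ hμ ω s s2 s3 s5
        s6 s8 sm st (by omega) hG2 (by omega) hmG hnG
    · rintro t ⟨t3, t7, tm⟩
      exact Runs.add ⟨by simp [State.setReg_reg, t3, t7, s7], tm⟩
  obtain ⟨t, ht, s, hex, hs0, hsm⟩ := hrun
  refine ⟨t, ht.trans (timeBound_ge hG), s, hex, hs0, fun i j => ?_⟩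
  have hij : (i : ℕ) * N + (j : ℕ) < cQ * (k * L) * N := by
    have h1 : ((i : ℕ) + 1) * N ≤ cQ * (k * L) * N := Nat.mul_le_mul_right _ i.2
    have h2 := j.2
    rw [add_mul] at h1
    omega
  simp only [bitSign, hsm _ hij]

end RandRAM

/-! ### The bias of the computed signs and the choice of parameters -/

open RandRAM

theorem cellSum_bitAt_eq {K : Type*} [Field K] [Algebra (ZMod 2) K] (ζ : K) {r base m : ℕ}
    (ω : Fin r → Bool) (g : Fin m → Fin r) (hg : ∀ c, (g c : ℕ) = base + c) :
    cellSum ζ (bitAt ω) base m =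
      ∑ c : Fin m, (((ω (g c)).toNat : ℕ) : ZMod 2) • ζ ^ (c : ℕ) := by
  rw [cellSum, Finset.sum_range]
  refine Finset.sum_congr rfl fun c _ => ?_
  have h1 : bitAt ω (base + c) = (ω (g c)).toNat := by
    rw [bitAt, dif_pos (hg c ▸ (g c).2)]
    congr 2
    exact Fin.ext (hg c).symm
  rw [h1, Algebra.smul_def, map_natCast]

/-- The bias of the computed signs. The coordinate vectors of `x` and `y` are longer than the degree
of the field, but uniform random bits still give uniform elements because the powers of `ζ` span
it. -/
theorem abs_expect_prod_bitSign_le {K : Type} [Field K] [Fintype K] [Algebra (ZMod 2) K]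
    (μ : K →ₗ[ZMod 2] ZMod 2) (hμ : ∃ a, μ a = 1) (ζ : K) (m : ℕ)
    (hspan : ∀ a : K, ∃ v : Fin m → ZMod 2, ∑ i, v i • ζ ^ (i : ℕ) = a) {ι : Type*}
    (e : ι → ℕ) (he : Function.Injective e) (n : ℕ) (hn : ∀ i, e i < n) (U : Finset ι)
    (hU : U.Nonempty) :
    |Finset.expect Finset.univ (fun ω : Fin (m + m) → Bool => ∏ i ∈ U,
      (bitSign (μ (cellSum ζ (bitAt ω) m m * cellSum ζ (bitAt ω) 0 m ^ e i)) : ℝ))| ≤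
      n / Fintype.card K := by
  let φ : (Fin (m + m) → ZMod 2) →+ K × K :=
    { toFun := fun v => (∑ c : Fin m, v (Fin.castAdd m c) • ζ ^ (c : ℕ),
        ∑ c : Fin m, v (Fin.natAdd m c) • ζ ^ (c : ℕ))
      map_zero' := by simp
      map_add' := fun v w => by simp [add_smul, Finset.sum_add_distrib] }
  have hφ : Function.Surjective φ := by
    rintro ⟨x, y⟩
    obtain ⟨v, hv⟩ := hspan x
    obtain ⟨w, hw⟩ := hspan y
    refine ⟨Fin.append v w, Prod.ext ?_ ?_⟩
    · simpa only [φ, AddMonoidHom.coe_mk, ZeroHom.coe_mk, Fin.append_left] using hv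
    · simpa only [φ, AddMonoidHom.coe_mk, ZeroHom.coe_mk, Fin.append_right] using hw
  have hbool : Function.Bijective (fun b : Bool => ((b.toNat : ℕ) : ZMod 2)) := by
    constructor
    · intro a b
      cases a <;> cases b <;> simp
    · decide
  have key := abs_expect_prod_powering_le μ hμ e he n hn U hU
  rw [← expect_comp_of_surjective φ hφ (fun xy : K × K =>
    ∏ i ∈ U, (bitSign (μ (xy.2 * xy.1 ^ e i)) : ℝ))] at key
  refine le_trans (le_of_eq (congrArg abs ?_)) key
  refine Fintype.expect_equiv (Equiv.arrowCongr (Equiv.refl _) (Equiv.ofBijective _ hbool)) _ _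
    fun ω => ?_
  rw [cellSum_bitAt_eq ζ ω (Fin.natAdd m) (fun _ => rfl),
    cellSum_bitAt_eq ζ ω (Fin.castAdd m) (fun c => by simp)]
  rfl

/-- The degree of the field is large enough for bias `(k b)^(-p)` with `p = 2 a k L`. -/
theorem size_mul_pow_le {cQ a b k L N e : ℕ} (hL : 1 ≤ L) (he : 1 ≤ e) (hk : 1 ≤ k)
    (hN : N ≤ k * 3 ^ L) (hke : k ≤ 3 ^ e) :
    cQ * (k * L) * N * (k * b) ^ (2 * a * (k * L)) ≤
      4 ^ (e * ((cQ + 4 + 2 * a + 2 * a * b) * (k * L))) := by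
  obtain ⟨W, hW⟩ : ∃ W, W = e * (k * L) := ⟨_, rfl⟩
  have hlt : ∀ n : ℕ, n ≤ 4 ^ n := fun n => (Nat.lt_pow_self (by norm_num)).le
  have hLW : L ≤ W := by
    rw [hW, ← mul_assoc]
    exact Nat.le_mul_of_pos_left _ (by positivity)
  have hkW : k ≤ W := by
    rw [hW, mul_left_comm]
    exact Nat.le_mul_of_pos_right _ (by positivity)
  have hkLW : k * L ≤ W := by
    rw [hW]
    exact Nat.le_mul_of_pos_left _ he
  have hW1 : 1 ≤ W := hL.trans hLW
  have up : ∀ n : ℕ, n ≤ W → n ≤ 4 ^ W := fun n hn =>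
    (hlt n).trans (Nat.pow_le_pow_right (by norm_num) hn)
  have h1 : cQ ≤ 4 ^ (cQ * W) := (hlt cQ).trans
    (Nat.pow_le_pow_right (by norm_num) (Nat.le_mul_of_pos_right _ hW1))
  have h2 : N ≤ 4 ^ W * 4 ^ W := hN.trans (Nat.mul_le_mul (up k hkW)
    ((Nat.pow_le_pow_left (by norm_num) L).trans (Nat.pow_le_pow_right (by norm_num) hLW)))
  have h3 : k ^ (2 * a * (k * L)) ≤ 4 ^ (2 * a * W) := by
    calc k ^ (2 * a * (k * L)) ≤ (4 ^ e) ^ (2 * a * (k * L)) :=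
          Nat.pow_le_pow_left (hke.trans (Nat.pow_le_pow_left (by norm_num) e)) _
      _ = 4 ^ (2 * a * W) := by rw [← pow_mul, hW]; congr 1; ring
  have h4 : b ^ (2 * a * (k * L)) ≤ 4 ^ (2 * a * b * W) := by
    calc b ^ (2 * a * (k * L)) ≤ (4 ^ b) ^ (2 * a * (k * L)) := Nat.pow_le_pow_left (hlt b) _
      _ = 4 ^ (2 * a * b * (k * L)) := by rw [← pow_mul]; congr 1; ring
      _ ≤ _ := Nat.pow_le_pow_right (by norm_num) (Nat.mul_le_mul_left _ hkLW)
  rw [mul_pow]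
  calc _ ≤ 4 ^ (cQ * W) * (4 ^ W * 4 ^ W) * (4 ^ W * 4 ^ W) *
        (4 ^ (2 * a * W) * 4 ^ (2 * a * b * W)) := by
        have h5 := up k hkW
        have h6 := up L hLW
        gcongr
    _ = _ := by
        rw [hW, ← pow_add, ← pow_add, ← pow_add, ← pow_add, ← pow_add]
        congr 1
        ring

theorem log_div_le_triplings {N k : ℕ} (hk : 1 ≤ k) (hkN : k < N) :
    Real.log (N / k) ≤ 2 * triplings k N := by
  have hk0 : (0 : ℝ) < k := by exact_mod_cast hk
  have hN0 : (0 : ℝ) < N := hk0.trans (by exact_mod_cast hkN)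
  have h1 : (N : ℝ) ≤ k * 3 ^ triplings k N := by exact_mod_cast triplings_spec k N hk
  have h2 : Real.log (N / k) ≤ Real.log (3 ^ triplings k N) := by
    apply Real.log_le_log (by positivity)
    rw [div_le_iff₀ hk0]
    linarith
  have h3 : Real.log 3 ≤ 2 := by
    have := Real.log_le_sub_one_of_pos (show (0 : ℝ) < 3 by norm_num)
    linarith
  rw [Real.log_pow] at h2
  have h4 : (0 : ℝ) ≤ triplings k N := Nat.cast_nonneg _
  nlinarith

theorem triplings_le_log_add_one {N k : ℕ} (hk : 1 ≤ k) (hkN : k < N) :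
    (triplings k N : ℝ) ≤ Real.log (N / k) + 1 := by
  have hk0 : (0 : ℝ) < k := by exact_mod_cast hk
  rcases Nat.eq_zero_or_eq_succ_pred (triplings k N) with h | h
  · rw [h, Nat.cast_zero]
    have : 0 ≤ Real.log (N / k) := Real.log_nonneg (by
      rw [le_div_iff₀ hk0, one_mul]
      exact_mod_cast hkN.le)
    linarith
  · have h1 := lt_of_lt_triplings (a := k) (T := N) (e := (triplings k N).pred) (by omega)
    have h2 : (k : ℝ) * 3 ^ (triplings k N).pred ≤ N := by exact_mod_cast h1.le
    have h3 : Real.log (3 ^ (triplings k N).pred) ≤ Real.log (N / k) := by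
      apply Real.log_le_log (by positivity)
      rw [le_div_iff₀ hk0]
      linarith
    have h4 : 1 ≤ Real.log 3 := by
      rw [Real.le_log_iff_exp_le (by norm_num)]
      exact Real.exp_one_lt_d9.le.trans (by norm_num)
    rw [Real.log_pow] at h3
    have h5 : (0 : ℝ) ≤ ((triplings k N).pred : ℝ) := Nat.cast_nonneg _
    have h6 : (triplings k N : ℝ) = ((triplings k N).pred : ℝ) + 1 := by
      conv_lhs => rw [h]
      push_cast
      ring
    nlinarith

theorem rpow_bias_eq {k b p : ℕ} (hp : 0 < p) (hb : 0 < b) (hk : 0 < k) {Q : ℕ}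
    (hQ : Q = b ^ 2 * p) :
    ((k : ℝ) ^ 2 * Q / p) ^ (-(p : ℝ) / 2) = (((k : ℝ) * b) ^ p)⁻¹ := by
  have hp' : (p : ℝ) ≠ 0 := by exact_mod_cast hp.ne'
  have h0 : (0 : ℝ) ≤ (k : ℝ) * b := by positivity
  have h1 : (k : ℝ) ^ 2 * Q / p = ((k : ℝ) * b) ^ (2 : ℝ) := by
    rw [hQ, Real.rpow_two]
    push_cast
    field_simp
  rw [h1, ← Real.rpow_mul h0, ← Real.rpow_natCast, ← Real.rpow_neg h0]
  congr 1
  ring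

theorem theorem1 (η θ A : ℝ) (hη : 0 < η) (hθ : 1 < θ) (hA : 0 < A) :
    ∃ (C : ℝ) (P : RandRAM.Prog) (T : Polynomial ℕ), 0 < C ∧
      ∀ N k : ℕ, 1 ≤ k → θ * (k : ℝ) ≤ (N : ℝ) →
        ∃ (Q r ℓ : ℕ) (S : (Fin r → Bool) → Fin Q × Fin N → ℤ),
          -- number of rows
          (Q : ℝ) ≤ C * ((k : ℝ) * Real.log ((N : ℝ) / k)) ∧
          -- number of random bits
          (r : ℝ) ≤ C * ((k : ℝ) * Real.log k * Real.log ((N : ℝ) / k)) ∧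
          -- the matrix is computed from the random bits in time polynomial in `N`
          (∀ ω : Fin r → Bool, RandRAM.Outputs P N k ω (T.eval N) Q (S ω)) ∧
          -- the signs of the entries have small bias
          ((k : ℝ) * Real.log ((N : ℝ) / k) ≤ C * ℓ ∧ ℓ ≤ Q ∧
            IsBiased S (((k : ℝ) ^ 2 * Q / ℓ) ^ (-(ℓ : ℝ) / 2)) ℓ) ∧
          -- the restricted isometry property holds with high probability
          1 - Real.exp (-(A * ((k : ℝ) * Real.log ((N : ℝ) / k)))) ≤
            uniformProb {ω : Fin r → Bool | HasRIP k η (scaledMatrix (S ω))} := by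
  have hlogθ : 0 < Real.log θ := Real.log_pos hθ
  obtain ⟨D, hD, hDη⟩ : ∃ D : ℕ, 16 ≤ D ∧ 16 / (D : ℝ) ≤ η := by
    refine ⟨max 16 ⌈16 / η⌉₊, le_max_left _ _, ?_⟩
    have h1 : 16 / η ≤ ((max 16 ⌈16 / η⌉₊ : ℕ) : ℝ) :=
      (Nat.le_ceil _).trans (by exact_mod_cast le_max_right _ _)
    rw [div_le_iff₀ hη] at h1
    rw [div_le_iff₀ (by positivity)]
    linarith
  obtain ⟨b, hb, hbD⟩ : ∃ b : ℕ, 8 ≤ b ∧ Real.exp 9 * D ≤ b :=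
    ⟨max 8 ⌈Real.exp 9 * D⌉₊, le_max_left _ _,
      (Nat.le_ceil _).trans (by exact_mod_cast le_max_right _ _)⟩
  obtain ⟨a, ha0, ha⟩ : ∃ a : ℕ, 1 ≤ a ∧ 2 * (1 + A) + D + 4 ≤ 2 * a := by
    refine ⟨⌈A⌉₊ + D + 3, by omega, ?_⟩
    have := Nat.le_ceil A
    have : (0 : ℝ) ≤ D := Nat.cast_nonneg _
    push_cast
    linarith
  obtain ⟨cQ, hcQ⟩ : ∃ cQ : ℕ, cQ = b ^ 2 * (2 * a) := ⟨_, rfl⟩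
  -- the terms of `cM` pay for the factors `cQ`, `k`, `L`, `N ≤ k 3^L`, and `(k b)^p` of `1 / ε`
  obtain ⟨cM, hcM⟩ : ∃ cM : ℕ, cM = cQ + 4 + 2 * a + 2 * a * b := ⟨_, rfl⟩
  -- since `log (N / k) ≥ log θ`, the rounding in `L` costs only a constant factor
  obtain ⟨cL, hcL⟩ : ∃ cL : ℝ, cL = 1 + 1 / Real.log θ := ⟨_, rfl⟩
  have hcL0 : 0 < cL := by rw [hcL]; positivity
  have hcQ0 : 1 ≤ cQ := by rw [hcQ]; exact Nat.one_le_iff_ne_zero.mpr (by positivity)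
  obtain ⟨C, hC⟩ : ∃ C : ℝ, C = (cQ + 54 * cM) * cL + 2 := ⟨_, rfl⟩
  have hC0 : 0 < C := by rw [hC]; positivity
  refine ⟨C, matrixProg cQ cM, timeBound cQ cM, hC0, ?_⟩
  intro N k hk hθN
  have hk0 : (0 : ℝ) < k := by exact_mod_cast hk
  have hkN' : (k : ℝ) < N := by nlinarith
  have hkN : k < N := by exact_mod_cast hkN'
  obtain ⟨Λ, hΛ⟩ : ∃ Λ, Λ = Real.log ((N : ℝ) / k) := ⟨_, rfl⟩
  have hΛθ : Real.log θ ≤ Λ := by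
    rw [hΛ]
    apply Real.log_le_log (by linarith)
    rwa [le_div_iff₀ hk0]
  have hΛ0 : 0 < Λ := hlogθ.trans_le hΛθ
  have hLΛ : (triplings k N : ℝ) ≤ cL * Λ := by
    have h1 := triplings_le_log_add_one hk hkN
    rw [← hΛ] at h1
    have h2 : 1 ≤ 1 / Real.log θ * Λ := by
      rw [one_div, inv_mul_eq_div, le_div_iff₀ hlogθ]
      linarith
    rw [hcL]
    linarith
  have hΛL := log_div_le_triplings hk hkN
  rw [← hΛ] at hΛL ⊢
  have hL0 : 1 ≤ triplings k N := by
    by_contra hcon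
    rw [show triplings k N = 0 by omega] at hΛL
    simp at hΛL
    linarith
  have hrows : ((cQ * (k * triplings k N) : ℕ) : ℝ) ≤ C * (k * Λ) := by
    push_cast
    calc (cQ : ℝ) * (k * triplings k N) ≤ cQ * (k * (cL * Λ)) := by gcongr
      _ = (cQ * cL) * (k * Λ) := by ring
      _ ≤ C * (k * Λ) := by
          gcongr
          rw [hC, add_mul]
          have : 0 ≤ 54 * (cM : ℝ) * cL := by positivity
          linarith
  rcases Nat.eq_or_lt_of_le hk with hk1 | hk2
  -- For `k = 1` the bound on `r` leaves no random bit; `ℓ = Q` makes the allowed bias equal to `1`.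
  · subst hk1
    refine ⟨cQ * (1 * triplings 1 N), 0, cQ * (1 * triplings 1 N), fun _ _ => 1, hrows, ?_,
      fun ω => matrixProg_outputs_one cQ cM N (by omega) ω, ⟨?_, le_rfl, ?_⟩, ?_⟩
    · simp
    · have h1 : (1 : ℝ) ≤ cQ := by exact_mod_cast hcQ0
      have h2 : 2 ≤ C := by
        rw [hC]
        have : 0 ≤ ((cQ : ℝ) + 54 * cM) * cL := by positivity
        linarith
      push_cast
      rw [one_mul, one_mul]
      calc Λ ≤ 2 * (1 * (triplings 1 N : ℝ)) := by linarith
        _ ≤ C * (cQ * (triplings 1 N : ℝ)) := by gcongr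
    · refine ⟨fun _ _ => Or.inl rfl, fun y _ _ => ?_⟩
      have hQ0 : ((cQ * (1 * triplings 1 N) : ℕ) : ℝ) ≠ 0 := by
        rw [Nat.cast_ne_zero]
        exact (Nat.mul_pos hcQ0 (by omega)).ne'
      refine le_of_le_of_eq (b := 1) (by simp) ?_
      rw [Nat.cast_one, one_pow, one_mul, div_self hQ0, Real.one_rpow]
    · have h1 : {ω : Fin 0 → Bool | HasRIP 1 η (scaledMatrix
          (fun _ : Fin (cQ * (1 * triplings 1 N)) × Fin N => (1 : ℤ)))} = Set.univ :=
        Set.eq_univ_of_forall fun ω =>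
          hasRIP_one (Nat.mul_pos hcQ0 (by omega)) hη.le _ fun _ => Or.inl rfl
      rw [h1, uniformProb, Set.ncard_univ, Nat.card_eq_fintype_card, div_self (by simp)]
      have := Real.exp_pos (-(A * (((1 : ℕ) : ℝ) * Λ)))
      linarith
  · obtain ⟨l, hl⟩ : ∃ l, l = triplings 1 (triplings 1 k * (cM * (k * triplings k N))) := ⟨_, rfl⟩
    obtain ⟨K, _, _, _, ζ, μ, hcard, hζ, hμ, hspan⟩ := exists_field_with_root l
    have hμ1 : ∃ w, μ w = 1 := ⟨ζ ^ 0, by rw [hμ 0 (by positivity)]; simp⟩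
    obtain ⟨p, hp⟩ : ∃ p, p = 2 * a * (k * triplings k N) := ⟨_, rfl⟩
    have hkL0 : 1 ≤ k * triplings k N := Nat.mul_pos hk hL0
    have hp0 : 0 < p := by rw [hp]; positivity
    have hQp : cQ * (k * triplings k N) = b ^ 2 * p := by rw [hcQ, hp]; ring
    have he0 : 1 ≤ triplings 1 k := by
      by_contra hcon
      have h1 := triplings_spec 1 k le_rfl
      rw [show triplings 1 k = 0 by omega] at h1
      omega
    have hbias : ∀ y : Finset (Fin (cQ * (k * triplings k N)) × Fin N), y.Nonempty →
        |Finset.expect Finset.univ (fun ω : Fin (3 * 3 ^ l + 3 * 3 ^ l) → Bool => ∏ i ∈ y,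
          ((bitSign (μ (cellSum ζ (bitAt ω) (3 * 3 ^ l) (3 * 3 ^ l) *
            cellSum ζ (bitAt ω) 0 (3 * 3 ^ l) ^ ((i.1 : ℕ) * N + (i.2 : ℕ)))) : ℤ) : ℝ))| ≤
        (((k : ℝ) * b) ^ p)⁻¹ := by
      intro y hy
      refine (abs_expect_prod_bitSign_le μ hμ1 ζ _ hspan
        (fun i : Fin (cQ * (k * triplings k N)) × Fin N => (i.1 : ℕ) * N + (i.2 : ℕ)) ?_
        (cQ * (k * triplings k N) * N) ?_ y hy).trans ?_
      · rintro ⟨i, j⟩ ⟨i', j'⟩ h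
        have h1 := congrArg (· / N) h
        have h2 := congrArg (· % N) h
        have hN0 : 0 < N := by omega
        simp only [mul_comm _ N, Nat.mul_add_div hN0, Nat.mul_add_mod, Nat.div_eq_of_lt j.2,
          Nat.div_eq_of_lt j'.2, Nat.mod_eq_of_lt j.2, Nat.mod_eq_of_lt j'.2, add_zero] at h1 h2
        exact Prod.ext (Fin.ext h1) (Fin.ext h2)
      · rintro ⟨i, j⟩
        have h1 : ((i : ℕ) + 1) * N ≤ cQ * (k * triplings k N) * N := Nat.mul_le_mul_right _ i.2
        have h2 := j.2
        rw [add_mul] at h1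
        simp only
        omega
      · have h1 := size_mul_pow_le (cQ := cQ) (a := a) (b := b) hL0 he0 hk
          (triplings_spec k N hk) (by simpa using triplings_spec 1 k le_rfl)
        rw [← hcM, ← hp] at h1
        have h2 : triplings 1 k * (cM * (k * triplings k N)) ≤ 3 ^ l := by
          have := triplings_spec 1 (triplings 1 k * (cM * (k * triplings k N))) le_rfl
          rwa [one_mul, ← hl] at this
        have h3 : cQ * (k * triplings k N) * N * (k * b) ^ p ≤ Fintype.card K := by
          rw [hcard, pow_mul]
          exact h1.trans (Nat.pow_le_pow_right (by norm_num) h2)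
        have h4 : ((cQ * (k * triplings k N) * N : ℕ) : ℝ) * ((k : ℝ) * b) ^ p ≤
            Fintype.card K := by exact_mod_cast h3
        have hK0 : (0 : ℝ) < Fintype.card K := by exact_mod_cast Fintype.card_pos
        rw [div_le_iff₀ hK0, inv_mul_eq_div, le_div_iff₀ (by positivity)]
        exact h4
    refine ⟨cQ * (k * triplings k N), 3 * 3 ^ l + 3 * 3 ^ l, p, fun ω ij =>
      bitSign (μ (cellSum ζ (bitAt ω) (3 * 3 ^ l) (3 * 3 ^ l) *
        cellSum ζ (bitAt ω) 0 (3 * 3 ^ l) ^ ((ij.1 : ℕ) * N + (ij.2 : ℕ)))), hrows, ?_,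
      fun ω => matrixProg_outputs cQ cM N k _ (3 ^ l) (by omega) hk2 hkN μ ζ (by rw [hl]) rfl hζ
        hμ ω, ⟨?_, ?_, ?_⟩, ?_⟩
    · have h1 : 3 ^ l ≤ 3 * (triplings 1 k * (cM * (k * triplings k N))) := by
        rw [hl]
        refine three_pow_triplings_le (Nat.mul_pos he0 (Nat.mul_pos (by omega) hkL0))
      have h2 : ((3 * 3 ^ l + 3 * 3 ^ l : ℕ) : ℝ) ≤
          18 * (triplings 1 k * (cM * (k * triplings k N))) := by
        have h3 : 3 * 3 ^ l + 3 * 3 ^ l ≤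
          18 * (triplings 1 k * (cM * (k * triplings k N))) := by omega
        exact_mod_cast h3
      have hk2' : (2 : ℝ) ≤ k := by exact_mod_cast hk2
      have hlogk : 1 / 2 ≤ Real.log k := by
        have h3 := Real.log_two_gt_d9
        have h4 := Real.log_le_log (by norm_num) hk2'
        linarith
      have he : (triplings 1 k : ℝ) ≤ 3 * Real.log k := by
        have h3 := triplings_le_log_add_one le_rfl hk2
        rw [Nat.cast_one, div_one] at h3
        linarith
      calc _ ≤ 18 * ((triplings 1 k : ℝ) * (cM * (k * triplings k N))) := h2
        _ ≤ 18 * (3 * Real.log k * (cM * (k * (cL * Λ)))) := by gcongr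
        _ = (54 * cM * cL) * (k * Real.log k * Λ) := by ring
        _ ≤ C * (k * Real.log k * Λ) := by
            gcongr
            rw [hC, add_mul]
            have : 0 ≤ (cQ : ℝ) * cL := by positivity
            linarith
    · have h1 : (1 : ℝ) ≤ a := by exact_mod_cast ha0
      have h2 : 1 ≤ C := by
        rw [hC]
        have : 0 ≤ ((cQ : ℝ) + 54 * cM) * cL := by positivity
        linarith
      rw [hp]
      push_cast
      calc (k : ℝ) * Λ ≤ k * (2 * triplings k N) := by gcongr
        _ = 1 * (2 * 1 * (k * triplings k N)) := by ring
        _ ≤ C * (2 * a * (k * triplings k N)) := by gcongr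
    · rw [hQp]
      exact Nat.le_mul_of_pos_left _ (by positivity)
    · rw [rpow_bias_eq hp0 (by omega) hk hQp]
      refine ⟨fun ω i => ?_, fun y hy _ => hbias y (Finset.card_pos.mp hy)⟩
      simp only [bitSign]
      split_ifs <;> simp
    · have h1 := uniformProb_hasRIP_ge (A := A) (η := η) hQp hk hkN.le hb
        (by rw [hp, mul_assoc]; exact even_two_mul _) hp0 hD hDη hbD ?_ _ ?_ hbias
      · rw [← hΛ] at h1
        exact h1
      · rw [← hΛ, hp]
        push_cast
        have hkL : (1 : ℝ) ≤ k * triplings k N := by exact_mod_cast hkL0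
        have hL1 : (1 : ℝ) ≤ triplings k N := by exact_mod_cast hL0
        have e1 : (k : ℝ) ≤ k * triplings k N := le_mul_of_one_le_right hk0.le hL1
        have e2 : (1 + A) * (k * Λ) ≤ (1 + A) * (k * (2 * triplings k N)) := by gcongr
        have e3 : (k : ℝ) * D ≤ (k * triplings k N) * D := by gcongr
        have e4 : (2 * (1 + A) + D + 4) * ((k : ℝ) * triplings k N) ≤
            2 * a * (k * triplings k N) := by gcongr
        linarith
      · intro ω i
        simp only [bitSign]
        split_ifs <;> simp
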